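/- Let $q$ be a formal variable and let $\mathcal H_n$ be the Hecke algebra over $\mathbb C(q)$ with generators $T_1,\dots,T_{n-1}$ and relations $T_iT_{i+1}T_i=T_{i+1}T_iT_{i+1}$, $T_iT_j=T_jT_i$ for $|i-j|>1$, and $T_i^2=1+(q-q^{-1})T_i$ ($\mathcal H_0=\mathcal H_1=\mathbb C(q)$). The Jucys--Murphy elements are $y_1=1$, $y_{k+1}=T_ky_kT_k$. Let $\lambda$ be a partition of $n$, identified with its Young diagram, and let $\mathcal T$ be a standard $\lambda$-tableau. The $q$-content of a cell in row $i$ and column $j$ is $q^{2(j-i)}$; let $\sigma_k$ be the $q$-content of the cell occupied by $k$ in $\mathcal T$. The idempotent $E_{\mathcal T}\in\mathcal H_n$ is defined inductively by $E_{\mathcal T}=1$ for $n\le 1$ and $$E_{\mathcal T}=E_{\mathcal U}\,\prod_{\rho}\frac{y_n-\rho}{\sigma_n-\rho}\qquad(n\ge 2),$$ where $\mathcal U$ is obtained from $\mathcal T$ by removing the cell occupied by $n$, and $\rho$ runs over the $q$-contents of all addable cells of the shape of $\mathcal U$ other than the cell occupied by $n$ in $\mathcal T$. Put $$f(\lambda)=\prod_{\alpha\in\lambda}\frac{q^{c_\alpha}}{[h_\alpha]_q},\qquad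 [m]_q=\frac{q^m-q^{-m}}{q-q^{-1}},$$ where a cell $\alpha=(i,j)$ has content $c_\alpha=j-i$ and hook length $h_\alpha=\lambda_i+\lambda'_j-i-j+1$, with $\lambda'$ the conjugate partition. Let $Q\in\mathbb C(q)$. Let $\mathrm{Tr}_{m+1}:\mathcal H_{m+1}\to\mathcal H_m$ ($m\ge 0$) be the linear maps determined by the properties $$\mathrm{Tr}_{m+1}(XZY)=X\,\mathrm{Tr}_{m+1}(Z)\,Y,\qquad \mathrm{Tr}_{m+1}(X)=QX,$$ and, for $m\ge 1$, $$\mathrm{Tr}_{m+1}(T_m^{\pm1}XT_m^{\mp1})=\mathrm{Tr}_m(X),\qquad \mathrm{Tr}_{m+1}(T_m)=1,\qquad \mathrm{Tr}_m\mathrm{Tr}_{m+1}(T_mZ)=\mathrm{Tr}_m\mathrm{Tr}_{m+1}(ZT_m),$$ for $X,Y\in\mathcal H_m$ and $Z\in\mathcal H_{m+1}$. The quantum dimension of $\mathcal T$ is the Ocneanu--Markov trace $\mathrm{qdim}\,\mathcal T=\mathrm{Tr}_1\mathrm{Tr}_2\cdots\mathrm{Tr}_n(E_{\mathcal T})\in\mathbb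 C(q)$. Assume that $Q+\frac{\sigma_k-1}{q-q^{-1}}\neq 0$ for $k=1,\dots,n$ (for a constant $Q\in\mathbb C$ it is enough that $Q\ne0$). Then $$f(\lambda)=\mathrm{qdim}\,\mathcal T\;\prod_{k=1}^{n}\sigma_k\left(Q+\frac{\sigma_k-1}{q-q^{-1}}\right)^{-1}.$$ -/

import Mathlib

noncomputable section

namespace Hecke

/-! ### The Hecke algebra by generators and relations -/

/-- The index set `{1, …, n - 1}` of the generators of the Hecke algebra on `n` strands. -/
abbrev Gen (n : ℕ) : Type := {i : ℕ // 1 ≤ i ∧ i < n}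

/-- The defining relations of the Hecke algebra. -/
inductive Rel {K : Type} [Field K] (q : K) (n : ℕ) :
    FreeAlgebra K (Gen n) → FreeAlgebra K (Gen n) → Prop
  | braid (i j : Gen n) (h : j.1 = i.1 + 1) :
      Rel q n (FreeAlgebra.ι K i * FreeAlgebra.ι K j * FreeAlgebra.ι K i)
        (FreeAlgebra.ι K j * FreeAlgebra.ι K i * FreeAlgebra.ι K j)
  | comm (i j : Gen n) (h : i.1 + 1 < j.1) :
      Rel q n (FreeAlgebra.ι K i * FreeAlgebra.ι K j) (FreeAlgebra.ι K j * FreeAlgebra.ι K i)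
  | quad (i : Gen n) :
      Rel q n (FreeAlgebra.ι K i * FreeAlgebra.ι K i) (1 + (q - q⁻¹) • FreeAlgebra.ι K i)

/-- The Hecke algebra `H_n(q)` over the field `K`. -/
def HeckeAlgebra {K : Type} [Field K] (q : K) (n : ℕ) : Type := RingQuot (Rel q n)

instance {K : Type} [Field K] (q : K) (n : ℕ) : Ring (HeckeAlgebra q n) :=
  inferInstanceAs (Ring (RingQuot (Rel q n)))

instance {K : Type} [Field K] (q : K) (n : ℕ) : Algebra K (HeckeAlgebra q n) :=
  inferInstanceAs (Algebra K (RingQuot (Rel q n)))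

/-- The quotient map from the free algebra onto the Hecke algebra. -/
def mk {K : Type} [Field K] (q : K) (n : ℕ) : FreeAlgebra K (Gen n) →ₐ[K] HeckeAlgebra q n :=
  RingQuot.mkAlgHom K (Rel q n)

/-- The generator `T_i` of `H_n`, for `1 ≤ i < n` (and `0` for other indices, which are not used). -/
def T {K : Type} [Field K] (q : K) (n i : ℕ) : HeckeAlgebra q n :=
  if h : 1 ≤ i ∧ i < n then mk q n (FreeAlgebra.ι K ⟨i, h⟩) else 0

/-- The inverse `T_i - (q - q⁻¹)` of the generator `T_i`. -/
def Tinv {K : Type} [Field K] (q : K) (n i : ℕ) : HeckeAlgebra q n :=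
  T q n i - algebraMap K _ (q - q⁻¹)

section Basics

variable {K : Type} [Field K] {q : K} {n : ℕ}

theorem T_braid {i : ℕ} (h1 : 1 ≤ i) (h2 : i + 1 < n) :
    T q n i * T q n (i + 1) * T q n i = T q n (i + 1) * T q n i * T q n (i + 1) := by
  have e1 : 1 ≤ i ∧ i < n := by omega
  have e2 : 1 ≤ i + 1 ∧ i + 1 < n := by omega
  simp only [T, dif_pos e1, dif_pos e2, ← map_mul]
  exact RingQuot.mkAlgHom_rel K (Rel.braid ⟨i, e1⟩ ⟨i + 1, e2⟩ rfl)

theorem T_comm {i j : ℕ} (h1 : 1 ≤ i) (h : i + 1 < j) (h2 : j < n) :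
    T q n i * T q n j = T q n j * T q n i := by
  have e1 : 1 ≤ i ∧ i < n := by omega
  have e2 : 1 ≤ j ∧ j < n := by omega
  simp only [T, dif_pos e1, dif_pos e2, ← map_mul]
  exact RingQuot.mkAlgHom_rel K (Rel.comm ⟨i, e1⟩ ⟨j, e2⟩ h)

theorem T_quad {i : ℕ} (h1 : 1 ≤ i) (h2 : i < n) :
    T q n i * T q n i = 1 + (q - q⁻¹) • T q n i := by
  have e1 : 1 ≤ i ∧ i < n := by omega
  simp only [T, dif_pos e1, ← map_mul, ← map_smul]
  rw [← map_one (mk q n), ← map_add]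
  exact RingQuot.mkAlgHom_rel K (Rel.quad ⟨i, e1⟩)

theorem T_mul_Tinv {i : ℕ} (h1 : 1 ≤ i) (h2 : i < n) : T q n i * Tinv q n i = 1 := by
  rw [Tinv, mul_sub, T_quad h1 h2, ← Algebra.commutes, ← Algebra.smul_def]; abel

theorem Tinv_mul_T {i : ℕ} (h1 : 1 ≤ i) (h2 : i < n) : Tinv q n i * T q n i = 1 := by
  rw [Tinv, sub_mul, T_quad h1 h2, ← Algebra.smul_def]; abel

/-- The universal property of the Hecke algebra. -/
def lift (q : K) (n : ℕ) {A : Type} [Ring A] [Algebra K A] (f : ℕ → A)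
    (hb : ∀ i, 1 ≤ i → i + 1 < n → f i * f (i + 1) * f i = f (i + 1) * f i * f (i + 1))
    (hc : ∀ i j, 1 ≤ i → i + 1 < j → j < n → f i * f j = f j * f i)
    (hq : ∀ i, 1 ≤ i → i < n → f i * f i = 1 + (q - q⁻¹) • f i) :
    HeckeAlgebra q n →ₐ[K] A :=
  RingQuot.liftAlgHom K ⟨FreeAlgebra.lift K (fun i : Gen n => f i.1), by
    intro x y h
    cases h with
    | braid i j h =>
      simp only [map_mul, FreeAlgebra.lift_ι_apply, h]
      exact hb i.1 i.2.1 (h ▸ j.2.2)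
    | comm i j h =>
      simp only [map_mul, FreeAlgebra.lift_ι_apply]
      exact hc i.1 j.1 i.2.1 h j.2.2
    | quad i =>
      simp only [map_mul, map_add, map_one, map_smul, FreeAlgebra.lift_ι_apply]
      exact hq i.1 i.2.1 i.2.2⟩

theorem lift_T {A : Type} [Ring A] [Algebra K A] (f : ℕ → A)
    (hb : ∀ i, 1 ≤ i → i + 1 < n → f i * f (i + 1) * f i = f (i + 1) * f i * f (i + 1))
    (hc : ∀ i j, 1 ≤ i → i + 1 < j → j < n → f i * f j = f j * f i)
    (hq : ∀ i, 1 ≤ i → i < n → f i * f i = 1 + (q - q⁻¹) • f i)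
    {i : ℕ} (h1 : 1 ≤ i) (h2 : i < n) : lift q n f hb hc hq (T q n i) = f i := by
  have e1 : 1 ≤ i ∧ i < n := ⟨h1, h2⟩
  simp only [T, dif_pos e1]
  exact (RingQuot.liftAlgHom_mkAlgHom_apply K _ _ _).trans (by simp)

theorem induction {P : HeckeAlgebra q n → Prop} (hs : ∀ c : K, P (algebraMap K _ c))
    (hT : ∀ i, 1 ≤ i → i < n → P (T q n i)) (hm : ∀ x y, P x → P y → P (x * y))
    (ha : ∀ x y, P x → P y → P (x + y)) (x : HeckeAlgebra q n) : P x := by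
  obtain ⟨y, rfl⟩ : ∃ y, mk q n y = x := RingQuot.mkAlgHom_surjective K (Rel q n) x
  induction y using FreeAlgebra.induction with
  | grade0 c => rw [AlgHom.commutes]; exact hs c
  | grade1 i =>
    have := hT i.1 i.2.1 i.2.2
    rwa [T, dif_pos i.2] at this
  | mul a b ha hb => rw [map_mul]; exact hm _ _ ha hb
  | add a b h1 h2 => rw [map_add]; exact ha _ _ h1 h2

end Basics

/-- The natural embedding `H_n → H_{n+1}`, `T_i ↦ T_i`. -/
def incl {K : Type} [Field K] (q : K) (n : ℕ) : HeckeAlgebra q n →ₐ[K] HeckeAlgebra q (n + 1) :=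
  lift q n (T q (n + 1)) (fun _ h1 h2 => T_braid h1 (by omega))
    (fun _ _ h1 h h2 => T_comm h1 h (by omega)) (fun _ h1 h2 => T_quad h1 (by omega))

/-- The algebra `H_0` has no generators and is the ground field. -/
def zeroEquiv {K : Type} [Field K] (q : K) : HeckeAlgebra q 0 ≃ₐ[K] K :=
  AlgEquiv.ofAlgHom
    (lift q 0 (fun _ => (0 : K)) (fun _ _ h => absurd h (by omega))
      (fun _ _ _ _ h => absurd h (by omega)) (fun _ _ h => absurd h (by omega)))
    (Algebra.ofId K _) (by ext)
    (AlgHom.ext fun x => by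
      induction x using induction with
      | hs c => simp
      | hT i h1 h2 => omega
      | hm x y hx hy => rw [map_mul, map_mul, hx, hy]
      | ha x y hx hy => rw [map_add, map_add, hx, hy])

/-! ### The Ocneanu--Markov trace -/

/-- The characterizing properties of the family of partial traces
`Tr_{m+1} : H_{m+1} → H_m`, `m ≥ 0`, with parameter `Q`. -/
structure IsPartialTrace {K : Type} [Field K] (q Q : K)
    (Tr : ∀ m : ℕ, HeckeAlgebra q (m + 1) →ₗ[K] HeckeAlgebra q m) : Prop where
  bimodule : ∀ (m : ℕ) (X Y : HeckeAlgebra q m) (Z : HeckeAlgebra q (m + 1)),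
    Tr m (incl q m X * Z * incl q m Y) = X * Tr m Z * Y
  scalar : ∀ (m : ℕ) (X : HeckeAlgebra q m), Tr m (incl q m X) = Q • X
  conj : ∀ (m : ℕ) (X : HeckeAlgebra q (m + 1)),
    Tr (m + 1) (T q (m + 2) (m + 1) * incl q (m + 1) X * Tinv q (m + 2) (m + 1)) =
      incl q m (Tr m X)
  conj' : ∀ (m : ℕ) (X : HeckeAlgebra q (m + 1)),
    Tr (m + 1) (Tinv q (m + 2) (m + 1) * incl q (m + 1) X * T q (m + 2) (m + 1)) =
      incl q m (Tr m X)
  gen : ∀ m : ℕ, Tr (m + 1) (T q (m + 2) (m + 1)) = 1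
  cyclic : ∀ (m : ℕ) (Z : HeckeAlgebra q (m + 2)),
    Tr m (Tr (m + 1) (T q (m + 2) (m + 1) * Z)) = Tr m (Tr (m + 1) (Z * T q (m + 2) (m + 1)))

section Existence

variable {K : Type} [Field K] {q : K} {m : ℕ}

theorem incl_T {i : ℕ} (h1 : 1 ≤ i) (h2 : i < m) : incl q m (T q m i) = T q (m + 1) i :=
  lift_T _ _ _ _ h1 h2

theorem exists_scalar (q : K) : ∃ s : K, s * s = 1 + (q - q⁻¹) * s := by
  by_cases h : q = 0
  · exact ⟨1, by simp [h]⟩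
  · exact ⟨q, by field_simp; ring⟩

/-- The left action of `T_i`, `1 ≤ i ≤ m`, on the free right `H_m`-module `H_{m+1}` with basis
`T_{j+1} ⋯ T_m`, `0 ≤ j ≤ m` (the coordinates with `j > m` are inert). -/
def act (q : K) (m i : ℕ) :
    (ℕ → HeckeAlgebra q m) →ₗ[K] (ℕ → HeckeAlgebra q m) where
  toFun v j :=
    if m < j then (exists_scalar q).choose • v j
    else if j = i then v (i - 1)
    else if j + 1 = i then v i + (q - q⁻¹) • v j
    else if i < j then T q m i * v j
    else T q m (i - 1) * v j
  map_add' v w := by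
    funext j
    simp only [Pi.add_apply]
    split_ifs <;> simp only [mul_add, smul_add]
    abel
  map_smul' c v := by
    funext j
    simp only [Pi.smul_apply, RingHom.id_apply]
    split_ifs <;> simp only [mul_smul_comm, smul_add, smul_comm c]

theorem act_big {i j : ℕ} (v : ℕ → HeckeAlgebra q m) (h : m < j) :
    act q m i v j = (exists_scalar q).choose • v j := by
  simp [act, h]

theorem act_self {i j : ℕ} (v : ℕ → HeckeAlgebra q m) (h : j = i) (h1 : j ≤ m) :
    act q m i v j = v (i - 1) := by
  simp [act, h, show ¬ m < i by omega]

theorem act_pred {i j : ℕ} (v : ℕ → HeckeAlgebra q m) (h : j + 1 = i) (h1 : i ≤ m) :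
    act q m i v j = v i + (q - q⁻¹) • v j := by
  simp [act, h, show ¬ m < j by omega, show ¬ j = i by omega]

theorem act_gt {i j : ℕ} (v : ℕ → HeckeAlgebra q m) (h : i < j) (h1 : j ≤ m) :
    act q m i v j = T q m i * v j := by
  simp [act, h, show ¬ m < j by omega, show ¬ j = i by omega, show ¬ j + 1 = i by omega]

theorem act_lt {i j : ℕ} (v : ℕ → HeckeAlgebra q m) (h : j + 1 < i) (h1 : i ≤ m) :
    act q m i v j = T q m (i - 1) * v j := by
  simp [act, show ¬ m < j by omega, show ¬ j = i by omega, show ¬ j + 1 = i by omega,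
    show ¬ i < j by omega]

theorem act_quad {i : ℕ} (h1 : 1 ≤ i) (h2 : i < m + 1) :
    act q m i * act q m i = 1 + (q - q⁻¹) • act q m i := by
  ext v j
  simp only [Module.End.mul_apply, LinearMap.add_apply, Module.End.one_apply, LinearMap.smul_apply,
    Pi.add_apply, Pi.smul_apply]
  rcases lt_or_ge m j with h | h
  · simp (disch := omega) only [act_big]
    rw [smul_smul, smul_smul, (exists_scalar q).choose_spec, add_smul, one_smul]
  rcases lt_trichotomy j i with h' | h' | h'
  · rcases (show j + 1 = i ∨ j + 1 < i by omega) with h' | h'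
    · subst h'
      simp (disch := omega) only [act_pred, act_self, Nat.add_sub_cancel]
    · simp (disch := omega) only [act_lt]
      rw [← mul_assoc, T_quad (by omega) (by omega), add_mul, one_mul, smul_mul_assoc]
  · subst h'
    have : j - 1 + 1 = j := by omega
    simp (disch := omega) only [act_pred, act_self]
  · simp (disch := omega) only [act_gt]
    rw [← mul_assoc, T_quad (by omega) (by omega), add_mul, one_mul, smul_mul_assoc]

theorem act_comm {i k : ℕ} (h1 : 1 ≤ i) (h : i + 1 < k) (h2 : k < m + 1) :
    act q m i * act q m k = act q m k * act q m i := by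
  obtain ⟨i, rfl⟩ : ∃ i', i = i' + 1 := ⟨i - 1, by omega⟩
  obtain ⟨k, rfl⟩ : ∃ k', k = k' + 1 := ⟨k - 1, by omega⟩
  ext v j
  simp only [Module.End.mul_apply]
  rcases lt_or_ge m j with h | h
  · simp (disch := omega) only [act_big]
  rcases (show j < i ∨ j = i ∨ j = i + 1 ∨ (i + 1 < j ∧ j < k) ∨ j = k ∨ j = k + 1 ∨ k + 1 < j
    by omega) with h' | h' | h' | h' | h' | h' | h'
  · simp (disch := omega) only [act_lt, Nat.add_sub_cancel]
    rw [← mul_assoc, ← mul_assoc, T_comm (by omega) (by omega) (by omega)]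
  · subst h'
    simp (disch := omega) only [act_lt, act_pred, Nat.add_sub_cancel]
    rw [mul_add, mul_smul_comm]
  · subst h'
    simp (disch := omega) only [act_lt, act_self, Nat.add_sub_cancel]
  · simp (disch := omega) only [act_lt, act_gt, Nat.add_sub_cancel]
    rw [← mul_assoc, ← mul_assoc, T_comm (by omega) (by omega) (by omega)]
  · subst h'
    simp (disch := omega) only [act_gt, act_pred]
    rw [mul_add, mul_smul_comm]
  · subst h'
    simp (disch := omega) only [act_gt, act_self, Nat.add_sub_cancel]
  · simp (disch := omega) only [act_gt]
    rw [← mul_assoc, ← mul_assoc, T_comm (by omega) (by omega) (by omega)]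

theorem act_braid {i : ℕ} (h1 : 1 ≤ i) (h2 : i + 1 < m + 1) :
    act q m i * act q m (i + 1) * act q m i =
      act q m (i + 1) * act q m i * act q m (i + 1) := by
  obtain ⟨i, rfl⟩ : ∃ i', i = i' + 1 := ⟨i - 1, by omega⟩
  ext v j
  simp only [Module.End.mul_apply]
  rcases lt_or_ge m j with h | h
  · simp (disch := omega) only [act_big]
  rcases (show j < i ∨ j = i ∨ j = i + 1 ∨ j = i + 2 ∨ i + 2 < j
    by omega) with h' | h' | h' | h' | h'
  · simp (disch := omega) only [act_lt, Nat.add_sub_cancel]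
    simp only [← mul_assoc]
    rw [T_braid (by omega) (by omega)]
  · subst h'
    simp (disch := omega) only [act_lt, act_gt, act_pred, act_self, Nat.add_sub_cancel]
    simp only [mul_add, mul_smul_comm]
    rw [← mul_assoc (T q m (j + 1)), T_quad (by omega) (by omega)]
    simp only [add_mul, one_mul, smul_mul_assoc, smul_add]
    abel
  · subst h'
    simp (disch := omega) only [act_lt, act_gt, act_pred, act_self, Nat.add_sub_cancel]
    simp only [mul_add, mul_smul_comm]
  · subst h'
    simp (disch := omega) only [act_lt, act_gt, act_self, Nat.add_sub_cancel]
  · simp (disch := omega) only [act_gt]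
    simp only [← mul_assoc]
    rw [T_braid (by omega) (by omega)]

/-- The left regular action of `H_{m+1}` in coordinates over `H_m`. -/
def regular (q : K) (m : ℕ) :
    HeckeAlgebra q (m + 1) →ₐ[K] Module.End K (ℕ → HeckeAlgebra q m) :=
  lift q (m + 1) (act q m) (fun _ => act_braid) (fun _ _ => act_comm) (fun _ => act_quad)

theorem regular_T {i : ℕ} (h1 : 1 ≤ i) (h2 : i < m + 1) :
    regular q m (T q (m + 1) i) = act q m i :=
  lift_T _ _ _ _ h1 h2

/-- The coordinates of the unit of `H_{m+1}`. -/
def unitVec (q : K) (m : ℕ) : ℕ → HeckeAlgebra q m := fun j => if j = m then 1 else 0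

theorem regular_mul_right (x : HeckeAlgebra q (m + 1)) (v : ℕ → HeckeAlgebra q m)
    (Y : HeckeAlgebra q m) :
    regular q m x (fun j => v j * Y) = fun j => regular q m x v j * Y := by
  induction x using induction generalizing v with
  | hs c => funext j; simp [Module.algebraMap_end_apply]
  | hT i h1 h2 =>
    rw [regular_T h1 h2]
    funext j
    simp only [act, LinearMap.coe_mk, AddHom.coe_mk]
    split_ifs <;> simp only [add_mul, smul_mul_assoc, mul_assoc]
  | hm x y hx hy => simp only [map_mul, Module.End.mul_apply, hx, hy]
  | ha x y hx hy =>
    simp only [map_add, LinearMap.add_apply, hx, hy]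
    funext j
    simp [add_mul]

theorem regular_incl_unitVec (Y : HeckeAlgebra q m) :
    regular q m (incl q m Y) (unitVec q m) = fun j => unitVec q m j * Y := by
  induction Y using induction with
  | hs c =>
    funext j
    rw [AlgHom.commutes, AlgHom.commutes, Module.algebraMap_end_apply, ← Algebra.commutes,
      ← Algebra.smul_def]
    rfl
  | hT i h1 h2 =>
    rw [incl_T h1 h2, regular_T h1 (by omega)]
    funext j
    simp only [act, LinearMap.coe_mk, AddHom.coe_mk, unitVec]
    split_ifs <;> first | omega | simp
  | hm x y hx hy =>
    simp only [map_mul, Module.End.mul_apply, hx, hy, regular_mul_right, mul_assoc]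
  | ha x y hx hy =>
    simp only [map_add, LinearMap.add_apply, hx, hy]
    funext j
    simp [mul_add]

/-- The product `T_{j+1} ⋯ T_{m-1}` in `H_m`. -/
def chain (q : K) (m j : ℕ) : HeckeAlgebra q m :=
  ((List.range' (j + 1) (m - 1 - j)).map (T q m)).prod

theorem chain_last (_h : 1 ≤ m) : chain q m (m - 1) = 1 := by simp [chain]

theorem chain_succ {j : ℕ} (h : j + 1 < m) : chain q m j = T q m (j + 1) * chain q m (j + 1) := by
  rw [chain, chain, show m - 1 - j = (m - 1 - (j + 1)) + 1 by omega, List.range'_succ]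
  simp

theorem T_mul_chain_lt {i j : ℕ} (h1 : 1 ≤ i) (_h : i < j) (h2 : j < m) :
    T q m i * chain q m j = chain q m j * T q m i := by
  induction hk : m - 1 - j generalizing j with
  | zero =>
    obtain rfl : j = m - 1 := by omega
    rw [chain_last (by omega), mul_one, one_mul]
  | succ k ih =>
    rw [chain_succ (by omega), ← mul_assoc, T_comm h1 (by omega) (by omega), mul_assoc,
      ih (by omega) (by omega) (by omega), mul_assoc]

theorem T_mul_chain_gt {i j : ℕ} (h : j + 1 < i) (h2 : i < m) :
    T q m i * chain q m j = chain q m j * T q m (i - 1) := by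
  induction hk : i - j generalizing j with
  | zero => omega
  | succ k ih =>
    rcases (show j + 2 = i ∨ j + 2 < i by omega) with rfl | h'
    · rw [chain_succ (by omega), chain_succ (by omega)]
      simp only [show j + 2 - 1 = j + 1 by omega]
      rw [← mul_assoc, ← mul_assoc, ← T_braid (by omega) (by omega), mul_assoc,
        T_mul_chain_lt (by omega) (by omega) (by omega)]
      simp only [mul_assoc]
    · rw [chain_succ (by omega), ← mul_assoc, ← T_comm (by omega) (by omega) (by omega), mul_assoc,
        ih (by omega) (by omega), mul_assoc]

/-- The functional on coordinates that gives the partial trace: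
`T_{j+1} ⋯ T_m ↦ T_{j+1} ⋯ T_{m-1}` for `j < m`, and `1 ↦ Q`. -/
def traceCoord (q Q : K) (m : ℕ) : (ℕ → HeckeAlgebra q m) →ₗ[K] HeckeAlgebra q m :=
  Q • LinearMap.proj m +
    ∑ j ∈ Finset.range m, (LinearMap.mulLeft K (chain q m j)).comp (LinearMap.proj j)

theorem traceCoord_apply (Q : K) (v : ℕ → HeckeAlgebra q m) :
    traceCoord q Q m v = Q • v m + ∑ j ∈ Finset.range m, chain q m j * v j := by
  simp [traceCoord]

theorem traceCoord_act (Q : K) {i : ℕ} (h1 : 1 ≤ i) (h2 : i < m) (v : ℕ → HeckeAlgebra q m) :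
    traceCoord q Q m (act q m i v) = T q m i * traceCoord q Q m v := by
  obtain ⟨i, rfl⟩ : ∃ i', i = i' + 1 := ⟨i - 1, by omega⟩
  rw [traceCoord_apply, traceCoord_apply, act_gt _ h2 le_rfl, mul_add, mul_smul_comm,
    Finset.mul_sum]
  congr 1
  rw [← sub_eq_zero, ← Finset.sum_sub_distrib,
    Finset.sum_eq_add_of_mem i (i + 1) (by simp; omega) (by simp; omega) (by omega)]
  · rw [act_pred v rfl (by omega), act_self v rfl (by omega), Nat.add_sub_cancel,
      ← mul_assoc, ← mul_assoc, ← chain_succ h2]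
    have : T q m (i + 1) * chain q m i = chain q m (i + 1) + (q - q⁻¹) • chain q m i := by
      rw [chain_succ h2, ← mul_assoc, T_quad h1 h2, add_mul, one_mul, smul_mul_assoc]
    rw [this]
    simp only [mul_add, add_mul, smul_mul_assoc, mul_smul_comm]
    abel
  · intro j hj hne
    have hj' := Finset.mem_range.mp hj
    rw [sub_eq_zero, ← mul_assoc]
    rcases (show j < i ∨ i + 1 < j by omega) with h | h
    · rw [act_lt v (by omega) (by omega), T_mul_chain_gt (by omega) h2, mul_assoc]
    · rw [act_gt v h (by omega), T_mul_chain_lt h1 h hj', mul_assoc]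

/-- An explicit partial trace; see `existsUnique_partialTrace`. -/
def explicitTrace (q Q : K) (m : ℕ) : HeckeAlgebra q (m + 1) →ₗ[K] HeckeAlgebra q m :=
  (traceCoord q Q m).comp
    ((LinearMap.applyₗ (R := K) (unitVec q m)).comp (regular q m).toLinearMap)

theorem explicitTrace_apply (Q : K) (x : HeckeAlgebra q (m + 1)) :
    explicitTrace q Q m x = traceCoord q Q m (regular q m x (unitVec q m)) := rfl

theorem explicitTrace_left (Q : K) (X : HeckeAlgebra q m) (z : HeckeAlgebra q (m + 1)) :
    explicitTrace q Q m (incl q m X * z) = X * explicitTrace q Q m z := by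
  induction X using induction generalizing z with
  | hs c => rw [AlgHom.commutes, ← Algebra.smul_def, ← Algebra.smul_def, map_smul]
  | hT i h1 h2 =>
    rw [incl_T h1 h2, explicitTrace_apply, map_mul, regular_T h1 (by omega),
      Module.End.mul_apply, traceCoord_act Q h1 h2, explicitTrace_apply]
  | hm x y hx hy => rw [map_mul (incl q m), mul_assoc, hx, hy, mul_assoc]
  | ha x y hx hy => rw [map_add, add_mul, map_add, hx, hy, add_mul]

theorem explicitTrace_right (Q : K) (z : HeckeAlgebra q (m + 1)) (Y : HeckeAlgebra q m) :
    explicitTrace q Q m (z * incl q m Y) = explicitTrace q Q m z * Y := by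
  rw [explicitTrace_apply, map_mul, Module.End.mul_apply, regular_incl_unitVec,
    regular_mul_right, explicitTrace_apply, traceCoord_apply, traceCoord_apply, add_mul,
    Finset.sum_mul, smul_mul_assoc]
  simp only [mul_assoc]

theorem explicitTrace_incl (Q : K) (X : HeckeAlgebra q m) :
    explicitTrace q Q m (incl q m X) = Q • X := by
  rw [explicitTrace_apply, regular_incl_unitVec, traceCoord_apply,
    Finset.sum_eq_zero fun j hj => by
      have := Finset.mem_range.mp hj
      simp [unitVec, show j ≠ m by omega]]
  simp [unitVec]

theorem explicitTrace_T (Q : K) (m : ℕ) :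
    explicitTrace q Q (m + 1) (T q (m + 2) (m + 1)) = 1 := by
  rw [explicitTrace_apply, regular_T (by omega) (by omega), traceCoord_apply,
    act_self _ rfl le_rfl, Finset.sum_eq_single m]
  · rw [act_pred _ rfl le_rfl]
    have := chain_last (q := q) (m := m + 1) (by omega)
    rw [Nat.add_sub_cancel] at this
    simp [unitVec, this]
  · intro j hj hne
    have := Finset.mem_range.mp hj
    rw [act_lt _ (by omega) le_rfl]
    simp [unitVec, show j ≠ m + 1 by omega]
  · simp

theorem T_comm_incl (x : HeckeAlgebra q m) :
    T q (m + 2) (m + 1) * incl q (m + 1) (incl q m x) =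
      incl q (m + 1) (incl q m x) * T q (m + 2) (m + 1) := by
  induction x using induction with
  | hs c => rw [AlgHom.commutes, AlgHom.commutes, Algebra.commutes]
  | hT i h1 h2 =>
    rw [incl_T h1 h2, incl_T h1 (by omega), T_comm h1 (by omega) (by omega)]
  | hm x y hx hy => rw [map_mul, map_mul, ← mul_assoc, hx, mul_assoc, hy, mul_assoc]
  | ha x y hx hy => rw [map_add, map_add, mul_add, add_mul, hx, hy]

/-- Every element of `H_{m+1}` is a sum of elements of `H_m` and of `H_m T_m H_m`. -/
theorem decomp (m : ℕ) : ∀ {P : HeckeAlgebra q (m + 1) → Prop}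
    (_ : ∀ x y, P x → P y → P (x + y)) (_ : ∀ a, P (incl q m a))
    (_ : 1 ≤ m → ∀ b c, P (incl q m b * T q (m + 1) m * incl q m c))
    (x : HeckeAlgebra q (m + 1)), P x := by
  induction m with
  | zero =>
    intro P _ hi _ x
    suffices h : ∃ a, incl q 0 a = x by
      obtain ⟨a, rfl⟩ := h
      exact hi a
    induction x using induction with
    | hs c => exact ⟨algebraMap K _ c, AlgHom.commutes _ c⟩
    | hT i h1 h2 => omega
    | hm x y hx hy =>
      obtain ⟨a, rfl⟩ := hx
      obtain ⟨b, rfl⟩ := hy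
      exact ⟨a * b, map_mul _ _ _⟩
    | ha x y hx hy =>
      obtain ⟨a, rfl⟩ := hx
      obtain ⟨b, rfl⟩ := hy
      exact ⟨a + b, map_add _ _ _⟩
  | succ m ih =>
    intro P ha hi hT x
    have h1 : 1 ≤ m + 1 := by omega
    -- the span of the two kinds of elements
    let S : AddSubmonoid (HeckeAlgebra q (m + 2)) := AddSubmonoid.closure
      (Set.range (incl q (m + 1)) ∪
        {z | ∃ b c, z = incl q (m + 1) b * T q (m + 2) (m + 1) * incl q (m + 1) c})
    have hSi : ∀ a, incl q (m + 1) a ∈ S := fun a =>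
      AddSubmonoid.subset_closure (Or.inl ⟨a, rfl⟩)
    have hST : ∀ b c, incl q (m + 1) b * T q (m + 2) (m + 1) * incl q (m + 1) c ∈ S := fun b c =>
      AddSubmonoid.subset_closure (Or.inr ⟨b, c, rfl⟩)
    have hleft : ∀ a z, z ∈ S → incl q (m + 1) a * z ∈ S := by
      intro a z hz
      induction hz using AddSubmonoid.closure_induction with
      | mem z hz =>
        rcases hz with ⟨b, rfl⟩ | ⟨b, c, rfl⟩
        · rw [← map_mul]; exact hSi _
        · rw [← mul_assoc, ← mul_assoc, ← map_mul]; exact hST _ _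
      | zero => rw [mul_zero]; exact S.zero_mem
      | add x y _ _ hx hy => rw [mul_add]; exact S.add_mem hx hy
    have hright : ∀ a z, z ∈ S → z * incl q (m + 1) a ∈ S := by
      intro a z hz
      induction hz using AddSubmonoid.closure_induction with
      | mem z hz =>
        rcases hz with ⟨b, rfl⟩ | ⟨b, c, rfl⟩
        · rw [← map_mul]; exact hSi _
        · rw [mul_assoc, ← map_mul]; exact hST _ _
      | zero => rw [zero_mul]; exact S.zero_mem
      | add x y _ _ hx hy => rw [add_mul]; exact S.add_mem hx hy
    have hTT : ∀ b, T q (m + 2) (m + 1) * incl q (m + 1) b * T q (m + 2) (m + 1) ∈ S := by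
      intro b
      refine ih (P := fun b =>
        T q (m + 2) (m + 1) * incl q (m + 1) b * T q (m + 2) (m + 1) ∈ S) ?_ ?_ ?_ b
      · intro x y hx hy
        rw [map_add, mul_add, add_mul]
        exact S.add_mem hx hy
      · intro a
        rw [T_comm_incl, mul_assoc, T_quad h1 (by omega), mul_add, mul_one]
        refine S.add_mem (hSi _) ?_
        have := hST (incl q m a) (algebraMap K _ (q - q⁻¹))
        rwa [AlgHom.commutes, ← Algebra.commutes, ← Algebra.smul_def, ← mul_smul_comm] at this
      · intro hm b c
        have : T q (m + 2) (m + 1) * incl q (m + 1) (incl q m b * T q (m + 1) m * incl q m c) *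
            T q (m + 2) (m + 1) = incl q (m + 1) (incl q m b) *
              (incl q (m + 1) (T q (m + 1) m) * T q (m + 2) (m + 1) *
                incl q (m + 1) (T q (m + 1) m)) * incl q (m + 1) (incl q m c) := by
          rw [incl_T hm (by omega), T_braid hm (by omega), map_mul, map_mul,
            incl_T hm (by omega), ← mul_assoc, ← mul_assoc, T_comm_incl]
          simp only [mul_assoc]
          rw [T_comm_incl]
        rw [this]
        exact hright _ _ (hleft _ _ (hST _ _))
    have hTl : ∀ z, z ∈ S → T q (m + 2) (m + 1) * z ∈ S := by
      intro z hz
      induction hz using AddSubmonoid.closure_induction with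
      | mem z hz =>
        rcases hz with ⟨b, rfl⟩ | ⟨b, c, rfl⟩
        · have := hST 1 b
          rwa [map_one, one_mul] at this
        · rw [← mul_assoc, ← mul_assoc]; exact hright _ _ (hTT b)
      | zero => rw [mul_zero]; exact S.zero_mem
      | add x y _ _ hx hy => rw [mul_add]; exact S.add_mem hx hy
    have hall : ∀ x z, z ∈ S → x * z ∈ S := by
      intro x
      induction x using induction with
      | hs c =>
        intro z hz
        have := hleft (algebraMap K _ c) z hz
        rwa [AlgHom.commutes] at this
      | hT i hi1 hi2 =>
        intro z hz
        rcases (show i < m + 1 ∨ i = m + 1 by omega) with h | rfl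
        · have := hleft (T q (m + 1) i) z hz
          rwa [incl_T hi1 h] at this
        · exact hTl z hz
      | hm x y hx hy => intro z hz; rw [mul_assoc]; exact hx _ (hy _ hz)
      | ha x y hx hy => intro z hz; rw [add_mul]; exact S.add_mem (hx _ hz) (hy _ hz)
    have hx : x ∈ S := by
      have := hall x 1 (by have := hSi 1; rwa [map_one] at this)
      rwa [mul_one] at this
    induction hx using AddSubmonoid.closure_induction with
    | mem z hz =>
      rcases hz with ⟨b, rfl⟩ | ⟨b, c, rfl⟩
      · exact hi b
      · exact hT h1 b c
    | zero => have := hi 0; rwa [map_zero] at this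
    | add x y _ _ hx hy => exact ha _ _ hx hy

theorem explicitTrace_conj (Q : K) (m : ℕ) (X : HeckeAlgebra q (m + 1)) :
    explicitTrace q Q (m + 1) (T q (m + 2) (m + 1) * incl q (m + 1) X *
      Tinv q (m + 2) (m + 1)) = incl q m (explicitTrace q Q m X) := by
  refine decomp m (P := fun X => explicitTrace q Q (m + 1) (T q (m + 2) (m + 1) *
    incl q (m + 1) X * Tinv q (m + 2) (m + 1)) = incl q m (explicitTrace q Q m X)) ?_ ?_ ?_ X
  · intro x y hx hy
    simp only [map_add, mul_add, add_mul, hx, hy]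
  · intro a
    rw [T_comm_incl, mul_assoc, T_mul_Tinv (by omega) (by omega), mul_one, explicitTrace_incl,
      explicitTrace_incl, map_smul]
  · intro hm b c
    obtain ⟨m, rfl⟩ : ∃ m', m = m' + 1 := ⟨m - 1, by omega⟩
    set t := T q (m + 3) (m + 2) with ht
    set s := T q (m + 3) (m + 1) with hs
    have hcomm : incl q (m + 2) (incl q (m + 1) c) * Tinv q (m + 3) (m + 2) =
        Tinv q (m + 3) (m + 2) * incl q (m + 2) (incl q (m + 1) c) := by
      rw [Tinv, mul_sub, sub_mul, T_comm_incl, Algebra.commutes]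
    have hbr : t * s * Tinv q (m + 3) (m + 2) = Tinv q (m + 3) (m + 1) * t * s := by
      have e1 : Tinv q (m + 3) (m + 1) * s = 1 := Tinv_mul_T (by omega) (by omega)
      have e2 : t * Tinv q (m + 3) (m + 2) = 1 := T_mul_Tinv (by omega) (by omega)
      have e3 : s * t * s = t * s * t := T_braid (by omega) (by omega)
      calc t * s * Tinv q (m + 3) (m + 2)
          = Tinv q (m + 3) (m + 1) * s * (t * s * Tinv q (m + 3) (m + 2)) := by rw [e1, one_mul]
        _ = Tinv q (m + 3) (m + 1) * (s * t * s) * Tinv q (m + 3) (m + 2) := by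
            simp only [mul_assoc]
        _ = Tinv q (m + 3) (m + 1) * t * s * (t * Tinv q (m + 3) (m + 2)) := by
            rw [e3]; simp only [mul_assoc]
        _ = _ := by rw [e2, mul_one]
    have hinv : incl q (m + 2) (Tinv q (m + 2) (m + 1)) = Tinv q (m + 3) (m + 1) := by
      rw [Tinv, map_sub, incl_T (by omega) (by omega), AlgHom.commutes, Tinv]
    have hsi : incl q (m + 2) (T q (m + 2) (m + 1)) = s := incl_T (by omega) (by omega)
    have : t * incl q (m + 2) (incl q (m + 1) b * T q (m + 2) (m + 1) * incl q (m + 1) c) *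
        Tinv q (m + 3) (m + 2) = incl q (m + 2) (incl q (m + 1) b * Tinv q (m + 2) (m + 1)) *
          (t * incl q (m + 2) (T q (m + 2) (m + 1) * incl q (m + 1) c)) := by
      simp only [map_mul, hsi, hinv]
      calc _ = (t * incl q (m + 2) (incl q (m + 1) b)) * s *
            (incl q (m + 2) (incl q (m + 1) c) * Tinv q (m + 3) (m + 2)) := by
              simp only [mul_assoc]
        _ = incl q (m + 2) (incl q (m + 1) b) * (t * s * Tinv q (m + 3) (m + 2)) *
            incl q (m + 2) (incl q (m + 1) c) := by
              rw [hcomm, ht, T_comm_incl]; simp only [mul_assoc]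
        _ = _ := by rw [hbr]; simp only [mul_assoc]
    rw [this, explicitTrace_left, explicitTrace_right, explicitTrace_T, explicitTrace_right,
      explicitTrace_left, explicitTrace_T, one_mul, mul_one, map_mul]
    rw [mul_assoc, ← mul_assoc (Tinv q (m + 2) (m + 1)), Tinv_mul_T (by omega) (by omega), one_mul]

theorem explicitTrace_conj' (Q : K) (m : ℕ) (X : HeckeAlgebra q (m + 1)) :
    explicitTrace q Q (m + 1) (Tinv q (m + 2) (m + 1) * incl q (m + 1) X *
      T q (m + 2) (m + 1)) = incl q m (explicitTrace q Q m X) := by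
  have h := explicitTrace_conj Q m X
  rw [Tinv, mul_sub, map_sub, ← Algebra.commutes, ← mul_assoc, ← Algebra.smul_def, smul_mul_assoc,
    map_smul, explicitTrace_right, explicitTrace_T, one_mul] at h
  rw [Tinv, sub_mul, sub_mul, map_sub, ← Algebra.smul_def, smul_mul_assoc, map_smul,
    explicitTrace_left, explicitTrace_T, mul_one, h]

theorem explicitTrace_cyclic (Q : K) (m : ℕ) (Z : HeckeAlgebra q (m + 2)) :
    explicitTrace q Q m (explicitTrace q Q (m + 1) (T q (m + 2) (m + 1) * Z)) =
      explicitTrace q Q m (explicitTrace q Q (m + 1) (Z * T q (m + 2) (m + 1))) := by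
  have key : ∀ X : HeckeAlgebra q (m + 1), explicitTrace q Q (m + 1)
      (T q (m + 2) (m + 1) * incl q (m + 1) X * T q (m + 2) (m + 1)) =
        incl q m (explicitTrace q Q m X) + (q - q⁻¹) • X := by
    intro X
    rw [← explicitTrace_conj Q m X, Tinv, mul_sub, map_sub, ← Algebra.commutes,
      ← Algebra.smul_def, map_smul, explicitTrace_right, explicitTrace_T, one_mul]
    abel
  refine decomp (m + 1) (P := fun Z => explicitTrace q Q m (explicitTrace q Q (m + 1)
    (T q (m + 2) (m + 1) * Z)) = explicitTrace q Q m (explicitTrace q Q (m + 1)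
      (Z * T q (m + 2) (m + 1)))) ?_ ?_ ?_ Z
  · intro x y hx hy
    simp only [mul_add, add_mul, map_add, hx, hy]
  · intro a
    rw [explicitTrace_left, explicitTrace_right, explicitTrace_T, one_mul, mul_one]
  · intro _ b c
    rw [← mul_assoc, ← mul_assoc, explicitTrace_right, key, mul_assoc, mul_assoc,
      explicitTrace_left, ← mul_assoc, key]
    simp only [mul_add, add_mul, map_add, explicitTrace_left, explicitTrace_right, smul_mul_assoc,
      mul_smul_comm, map_smul]

/-- The characterizing properties determine a unique family of partial traces. -/
theorem existsUnique_partialTrace (q Q : K) :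
    ∃! Tr : ∀ m : ℕ, HeckeAlgebra q (m + 1) →ₗ[K] HeckeAlgebra q m, IsPartialTrace q Q Tr := by
  refine ⟨explicitTrace q Q, ⟨?_, fun m => explicitTrace_incl Q, explicitTrace_conj Q,
    explicitTrace_conj' Q, explicitTrace_T Q, explicitTrace_cyclic Q⟩, ?_⟩
  · intro m X Y Z
    rw [explicitTrace_right, explicitTrace_left]
  · intro Tr h
    funext m
    refine LinearMap.ext fun x => ?_
    refine decomp m (P := fun x => Tr m x = explicitTrace q Q m x) ?_ ?_ ?_ x
    · intro x y hx hy
      rw [map_add, map_add, hx, hy]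
    · intro a
      rw [h.scalar, explicitTrace_incl]
    · intro hm b c
      obtain ⟨m, rfl⟩ : ∃ m', m = m' + 1 := ⟨m - 1, by omega⟩
      rw [h.bimodule, h.gen, explicitTrace_right, explicitTrace_left, explicitTrace_T]

end Existence

/-- The partial trace `Tr_{m+1} : H_{m+1} → H_m` with parameter `Q`. -/
def partialTrace {K : Type} [Field K] (q Q : K) :
    ∀ m : ℕ, HeckeAlgebra q (m + 1) →ₗ[K] HeckeAlgebra q m :=
  (existsUnique_partialTrace q Q).choose

theorem isPartialTrace_partialTrace {K : Type} [Field K] (q Q : K) :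
    IsPartialTrace q Q (partialTrace q Q) :=
  (existsUnique_partialTrace q Q).choose_spec.1

/-- The Ocneanu--Markov trace `Tr_1 Tr_2 ⋯ Tr_n : H_n → K`. -/
def ocneanuTrace {K : Type} [Field K] (q Q : K) : ∀ n : ℕ, HeckeAlgebra q n →ₗ[K] K
  | 0 => (zeroEquiv q).toLinearMap
  | n + 1 => (ocneanuTrace q Q n).comp (partialTrace q Q n)

/-! ### Jucys--Murphy elements, standard tableaux and idempotents -/

/-- The Jucys--Murphy element `y_{m+1}`, as an element of `H_{m+1}`. -/
def jucysMurphy {K : Type} [Field K] (q : K) : ∀ m : ℕ, HeckeAlgebra q (m + 1)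
  | 0 => 1
  | m + 1 => T q (m + 2) (m + 1) * incl q (m + 1) (jucysMurphy q m) * T q (m + 2) (m + 1)

/-- The content `j - i` of the cell in row `i` and column `j`. -/
def content (c : ℕ × ℕ) : ℤ := (c.2 : ℤ) - (c.1 : ℤ)

/-- The `q`-content `q ^ (2 (j - i))` of the cell in row `i` and column `j`. -/
def qContent {K : Type} [Field K] (q : K) (c : ℕ × ℕ) : K := q ^ (2 * content c)

/-- A cell outside `mu` is addable if adding it gives a diagram. -/
def IsAddable (mu : YoungDiagram) (c : ℕ × ℕ) : Prop :=
  c ∉ mu ∧ IsLowerSet ((insert c mu.cells : Finset (ℕ × ℕ)) : Set (ℕ × ℕ))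

theorem finite_isAddable (mu : YoungDiagram) : {c | IsAddable mu c}.Finite := by
  refine (Finset.finite_toSet
    (Finset.range (mu.colLen 0 + 1) ×ˢ Finset.range (mu.rowLen 0 + 1))).subset ?_
  rintro ⟨i, j⟩ ⟨-, hl⟩
  have key : ∀ c : ℕ × ℕ, c ≤ (i, j) → c ≠ (i, j) → c ∈ mu := by
    intro c hc hne
    have := hl hc (by simp)
    simpa [hne] using this
  simp only [Finset.coe_product, Set.mem_prod, Finset.mem_coe, Finset.mem_range]
  constructor
  · rcases i with _ | i
    · omega
    · have := YoungDiagram.mem_iff_lt_colLen.mp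
        (mu.up_left_mem le_rfl (Nat.zero_le j) (key (i, j) (by simp) (by simp)))
      omega
  · rcases j with _ | j
    · omega
    · have := YoungDiagram.mem_iff_lt_rowLen.mp
        (mu.up_left_mem (Nat.zero_le i) le_rfl (key (i, j) (by simp) (by simp)))
      omega

/-- The finite set of addable cells of a diagram. -/
def addable (mu : YoungDiagram) : Finset (ℕ × ℕ) := (finite_isAddable mu).toFinset

/-- A standard tableau of shape `lam` with `n` cells: a bijective filling of the cells with the
numbers `1, …, n` that increases along rows and down columns.  The cell `cell k` is the one that
contains the number `k + 1`. -/
structure StandardTableau (n : ℕ) (lam : YoungDiagram) where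
  cell : Fin n ≃ lam.cells
  row_increasing : ∀ k l : Fin n, (cell k).1.1 = (cell l).1.1 → (cell k).1.2 < (cell l).1.2 → k < l
  col_increasing : ∀ k l : Fin n, (cell k).1.2 = (cell l).1.2 → (cell k).1.1 < (cell l).1.1 → k < l

theorem StandardTableau.le_of_le {n : ℕ} {lam : YoungDiagram} (t : StandardTableau n lam)
    {k l : Fin n} (h : (t.cell k).1 ≤ (t.cell l).1) : k ≤ l := by
  have hmem : ((t.cell k).1.1, (t.cell l).1.2) ∈ lam :=
    lam.up_left_mem h.1 le_rfl ((YoungDiagram.mem_cells _).mp (t.cell l).2)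
  obtain ⟨p, hp⟩ := t.cell.surjective ⟨_, (YoungDiagram.mem_cells _).mpr hmem⟩
  have hp1 : (t.cell p).1.1 = (t.cell k).1.1 := by rw [hp]
  have hp2 : (t.cell p).1.2 = (t.cell l).1.2 := by rw [hp]
  have a : k ≤ p := by
    rcases h.2.lt_or_eq with h' | h'
    · exact (t.row_increasing k p hp1.symm (hp2 ▸ h')).le
    · exact (t.cell.injective (Subtype.ext (Prod.ext hp1.symm (h'.trans hp2.symm)))).le
  have b : p ≤ l := by
    rcases h.1.lt_or_eq with h' | h'
    · exact (t.col_increasing p l hp2 (hp1 ▸ h')).le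
    · exact (t.cell.injective (Subtype.ext (Prod.ext (hp1.trans h') hp2))).le
  exact a.trans b

/-- The shape of the standard tableau formed by the numbers `1, …, k` of a standard tableau. -/
def StandardTableau.shape {n : ℕ} {lam : YoungDiagram} (t : StandardTableau n lam) (k : ℕ) :
    YoungDiagram where
  cells := (Finset.univ.filter fun l : Fin n => l.1 < k).image fun l => (t.cell l).1
  isLowerSet := by
    intro a b hab ha
    simp only [Finset.coe_image, Finset.coe_filter, Finset.mem_univ, true_and, Set.mem_image,
      Set.mem_ofPred_eq] at ha ⊢
    obtain ⟨l, hl, rfl⟩ := ha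
    have hb : b ∈ lam.cells := lam.isLowerSet hab (t.cell l).2
    obtain ⟨p, hp⟩ := t.cell.surjective ⟨b, hb⟩
    refine ⟨p, ?_, by rw [hp]⟩
    have : p ≤ l := t.le_of_le (by rw [hp]; exact hab)
    exact lt_of_le_of_lt this hl

/-- The `q`-content `σ_{k+1}` of the cell occupied by `k + 1`. -/
def StandardTableau.sigma {K : Type} [Field K] (q : K) {n : ℕ} {lam : YoungDiagram}
    (t : StandardTableau n lam) (k : Fin n) : K := qContent q (t.cell k).1

/-- The idempotent in `H_k` of the tableau formed by the numbers `1, …, k` of a standard tableau: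
`E_{k+1} = E_k ∏ (y_{k+1} - ρ) / (σ_{k+1} - ρ)`, where `ρ` runs over the `q`-contents of the
addable cells, other than that of `k + 1`, of the shape of the numbers `1, …, k`. -/
def StandardTableau.partialIdempotent {K : Type} [Field K] (q : K) {n : ℕ} {lam : YoungDiagram}
    (t : StandardTableau n lam) : ∀ k : ℕ, k ≤ n → HeckeAlgebra q k
  | 0, _ => 1
  | k + 1, h =>
    incl q k (t.partialIdempotent q k (Nat.le_of_succ_le h)) *
      Polynomial.aeval (jucysMurphy q k)
        (∏ c ∈ (addable (t.shape k)).erase (t.cell ⟨k, h⟩).1,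
          Polynomial.C (t.sigma q ⟨k, h⟩ - qContent q c)⁻¹ *
            (Polynomial.X - Polynomial.C (qContent q c)))

/-- The primitive idempotent `E_T` of `H_n` associated with a standard tableau `T`. -/
def StandardTableau.idempotent {K : Type} [Field K] (q : K) {n : ℕ} {lam : YoungDiagram}
    (t : StandardTableau n lam) : HeckeAlgebra q n :=
  t.partialIdempotent q n le_rfl

/-- The quantum dimension of a standard tableau. -/
def StandardTableau.qdim {K : Type} [Field K] (q Q : K) {n : ℕ} {lam : YoungDiagram}
    (t : StandardTableau n lam) : K :=
  ocneanuTrace q Q n (t.idempotent q)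

/-- For a nonzero constant parameter `Q` none of the numbers `Q + (σ - 1) / (q - q⁻¹)`, with `σ` a
`q`-content and `q` a formal variable, vanishes. -/
theorem const_add_ne_zero {a : ℂ} (ha : a ≠ 0) (c : ℕ × ℕ) :
    RatFunc.C a + (qContent RatFunc.X c - 1) / (RatFunc.X - RatFunc.X⁻¹) ≠ (0 : RatFunc ℂ) := by
  have hX : (RatFunc.X : RatFunc ℂ) ≠ 0 := RatFunc.X_ne_zero
  have hinj := RatFunc.algebraMap_injective ℂ
  have hXX : (RatFunc.X : RatFunc ℂ) ^ 2 - 1 ≠ 0 := by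
    intro h
    have h' : (Polynomial.X ^ 2 - 1 : Polynomial ℂ) = 0 := by
      apply hinj
      simpa using h
    have := congrArg (fun p => Polynomial.coeff p 0) h'
    simp at this
  have hd : (RatFunc.X - RatFunc.X⁻¹ : RatFunc ℂ) ≠ 0 := by
    intro h
    apply hXX
    have := congrArg (fun x => RatFunc.X * x) h
    simp only [mul_sub, mul_inv_cancel₀ hX, mul_zero] at this
    rw [sq, this]
  intro h
  have h1 : RatFunc.C a * (RatFunc.X - RatFunc.X⁻¹) + (qContent RatFunc.X c - 1) = 0 := by
    field_simp at h ⊢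
    linear_combination h
  rw [qContent] at h1
  rcases lt_trichotomy (content c) 0 with hc | hc | hc
  · obtain ⟨d, hd1, hd2⟩ : ∃ d : ℕ, 1 ≤ d ∧ content c = -(d : ℤ) :=
      ⟨(content c).natAbs, by omega, by omega⟩
    rw [hd2, show (2 * -(d : ℤ)) = -((2 * d : ℕ) : ℤ) by push_cast; ring, zpow_neg,
      zpow_natCast] at h1
    have h2 : (Polynomial.C a * (Polynomial.X ^ (2 * d + 2) - Polynomial.X ^ (2 * d)) +
        (Polynomial.X - Polynomial.X ^ (2 * d + 1)) : Polynomial ℂ) = 0 := by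
      apply hinj
      simp only [map_add, map_mul, map_sub, map_pow, RatFunc.algebraMap_X, RatFunc.algebraMap_C,
        map_zero]
      field_simp at h1
      linear_combination h1
    have := congrArg (fun p => Polynomial.coeff p (2 * d + 2)) h2
    simp [Polynomial.coeff_X_pow, Polynomial.coeff_X] at this
    exact ha this
  · rw [hc] at h1
    simp [hd, ha] at h1
  · obtain ⟨d, hd1, hd2⟩ : ∃ d : ℕ, 1 ≤ d ∧ content c = (d : ℤ) :=
      ⟨(content c).natAbs, by omega, by omega⟩
    rw [hd2, show (2 * (d : ℤ)) = ((2 * d : ℕ) : ℤ) by push_cast; ring, zpow_natCast] at h1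
    have h2 : (Polynomial.C a * (Polynomial.X ^ 2 - 1) +
        (Polynomial.X ^ (2 * d + 1) - Polynomial.X) : Polynomial ℂ) = 0 := by
      apply hinj
      simp only [map_add, map_mul, map_sub, map_pow, RatFunc.algebraMap_X, RatFunc.algebraMap_C,
        map_zero, map_one]
      field_simp at h1
      linear_combination h1
    have := congrArg (fun p => Polynomial.coeff p 0) h2
    simp at this
    exact ha this

/-! ### The normalization factor -/

/-- The quantum integer `[k]_q`. -/
def qInt {K : Type} [Field K] (q : K) (k : ℤ) : K := (q ^ k - q ^ (-k)) / (q - q⁻¹)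

/-- The hook length `λ_i + λ'_j - i - j + 1` of the cell in row `i` and column `j`; Mathlib counts
rows and columns from `0`, which turns `+ 1` into `- 1`. -/
def hook (lam : YoungDiagram) (c : ℕ × ℕ) : ℤ :=
  (lam.rowLen c.1 : ℤ) + (lam.colLen c.2 : ℤ) - (c.1 : ℤ) - (c.2 : ℤ) - 1

/-- The normalization factor `f(λ)`. -/
def normFactor {K : Type} [Field K] (q : K) (lam : YoungDiagram) : K :=
  ∏ c ∈ lam.cells, q ^ content c / qInt q (hook lam c)

end Hecke

end

/-!
The quantum dimension is computed without representation theory, inside the commutative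
subalgebra generated by the Jucys--Murphy elements.  Write `κ = q - q⁻¹`.

Let `y = y_{m+1}` and `y' = y_{m+2} = T y T` with `T = T_{m+1}`.  Moving `T` past powers of `y` with
`y' T⁻¹ = T y` expresses `Tr_{m+2} (y' ^ k)` through `Tr_{m+1} (y ^ k)`, the element `y` and lower
powers of `y'` (`IsPartialTrace.jucysMurphy_pow`).  Hence `Tr_{m+1} (y_{m+1} ^ k)` is a polynomial in
`y_1, …, y_m`, and the trace of a polynomial in the Jucys--Murphy elements can be found recursively.

The recursion is solved by a weighted sum over all standard tableaux with `m` cells, at each of which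
the polynomial is evaluated at the contents (`ocneanuTrace_eq_growthSum`).  The weight of a tableau is
a product over its cells.  For a diagram `μ` with rows `0, …, N`, the last one empty, let
`x_i` be the `q`-content of the first cell after the end of row `i`.  Putting that cell has weight
`(κ Q + x_i - 1) / (κ x_i) * ∏_{s < N} (x_i - q⁻² x_s) / ∏_{s ≠ i} (x_i - x_s)`,
which vanishes if the cell cannot be added.  Lagrange interpolation at the nodes `x_i` gives the
first two moments of these weights (`moment_zero`, `moment_one`).  Adding a cell to row `c` replaces
`x_c` by `q² x_c`, and the moments then change by the same recursion as the elements
`Tr_{m+1} (y_{m+1} ^ k)` (`moment_update_one`, `moment_update_succ_succ`).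

The idempotent of a tableau is a product of Lagrange interpolants in the Jucys--Murphy elements; on
the contents of standard tableaux it is the indicator function of the given tableau
(`StandardTableau.exists_partialIdempotent_mem`).  So the quantum dimension is the weight of that
tableau.  The factor `(κ Q + x_i - 1) / (κ x_i)` of a weight is
`(Q + (σ - 1) / κ) / σ`, and the remaining factor is the ratio of the normalization factors of the
shapes after and before the cell is added (`StandardTableau.normFactor_shape_succ`), by a row by row
form of the product of the hook lengths.
-/

noncomputable section

namespace Hecke

variable {K : Type} [Field K] {q Q : K}

/-! ### The moments of a Jucys--Murphy element -/

theorem jucysMurphy_commute_incl (m : ℕ) (x : HeckeAlgebra q m) :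
    Commute (jucysMurphy q m) (incl q m x) := by
  induction m with
  | zero => exact Commute.one_left _
  | succ m ih =>
    induction x using induction with
    | hs c => rw [AlgHom.commutes]; exact (Algebra.commutes c _).symm
    | hm x y hx hy => rw [map_mul]; exact hx.mul_right hy
    | ha x y hx hy => rw [map_add]; exact hx.add_right hy
    | hT i h1 h2 =>
      rcases (show i < m ∨ i = m by omega) with h | rfl
      · -- `T_i` comes from `H_m` and commutes with every factor
        have hc : Commute (T q (m + 2) (m + 1)) (incl q (m + 1) (T q (m + 1) i)) := by
          rw [← incl_T h1 h]; exact T_comm_incl _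
        have hy : Commute (jucysMurphy q m) (T q (m + 1) i) := by
          rw [← incl_T h1 h]; exact ih _
        exact (hc.mul_left (hy.map (incl q (m + 1)))).mul_left hc
      · obtain ⟨k, rfl⟩ : ∃ k, i = k + 1 := ⟨i - 1, by omega⟩
        have hbr := T_braid (q := q) (n := k + 3) (i := k + 1) (by omega) (by omega)
        have hc := T_comm_incl (q := q) (jucysMurphy q k)
        rw [incl_T h1 (by omega), jucysMurphy, jucysMurphy, map_mul, map_mul,
          incl_T h1 (by omega)]
        generalize T q (k + 3) (k + 1) = s at *
        generalize T q (k + 3) (k + 2) = t at *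
        generalize incl q (k + 1 + 1) (incl q (k + 1) (jucysMurphy q k)) = y at *
        change t * (s * y * s) * t * s = s * (t * (s * y * s) * t)
        calc t * (s * y * s) * t * s = t * s * y * (s * t * s) := by simp only [mul_assoc]
          _ = t * s * (y * t) * s * t := by rw [hbr]; simp only [mul_assoc]
          _ = t * s * (t * y) * s * t := by rw [hc]
          _ = (t * s * t) * y * s * t := by simp only [mul_assoc]
          _ = _ := by rw [← hbr]; simp only [mul_assoc]

theorem jucysMurphy_succ_mul_Tinv (m : ℕ) :
    jucysMurphy q (m + 1) * Tinv q (m + 2) (m + 1) =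
      T q (m + 2) (m + 1) * incl q (m + 1) (jucysMurphy q m) := by
  rw [jucysMurphy, mul_assoc, T_mul_Tinv (by omega) (by omega), mul_one]

theorem jucysMurphy_succ_mul_T (m : ℕ) :
    jucysMurphy q (m + 1) * T q (m + 2) (m + 1) =
      T q (m + 2) (m + 1) * incl q (m + 1) (jucysMurphy q m) +
        (q - q⁻¹) • jucysMurphy q (m + 1) := by
  rw [← jucysMurphy_succ_mul_Tinv, Tinv, mul_sub, ← Algebra.commutes, ← Algebra.smul_def]
  abel

section Trace

variable {Tr : ∀ m : ℕ, HeckeAlgebra q (m + 1) →ₗ[K] HeckeAlgebra q m}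

theorem IsPartialTrace.mul_left (h : IsPartialTrace q Q Tr) (m : ℕ) (X : HeckeAlgebra q m)
    (Z : HeckeAlgebra q (m + 1)) : Tr m (incl q m X * Z) = X * Tr m Z := by
  simpa using h.bimodule m X 1 Z

theorem IsPartialTrace.mul_right (h : IsPartialTrace q Q Tr) (m : ℕ) (Y : HeckeAlgebra q m)
    (Z : HeckeAlgebra q (m + 1)) : Tr m (Z * incl q m Y) = Tr m Z * Y := by
  simpa using h.bimodule m 1 Y Z

theorem IsPartialTrace.jucysMurphy_pow_succ_mul_T (h : IsPartialTrace q Q Tr) (m k : ℕ) :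
    Tr (m + 1) (jucysMurphy q (m + 1) ^ (k + 1) * T q (m + 2) (m + 1)) =
      Tr (m + 1) (jucysMurphy q (m + 1) ^ k * T q (m + 2) (m + 1)) * jucysMurphy q m +
        (q - q⁻¹) • Tr (m + 1) (jucysMurphy q (m + 1) ^ (k + 1)) := by
  rw [pow_succ, mul_assoc, jucysMurphy_succ_mul_T, mul_add, map_add, ← mul_assoc, h.mul_right,
    mul_smul_comm, map_smul]

/-- Replacing one factor `y` of `T y ^ (k + 1) T⁻¹` by means of `T y = y' T⁻¹`. -/
theorem IsPartialTrace.conj_shift (h : IsPartialTrace q Q Tr) (m j k : ℕ) :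
    Tr (m + 1) (jucysMurphy q (m + 1) ^ j * T q (m + 2) (m + 1) *
        incl q (m + 1) (jucysMurphy q m ^ (k + 1)) * Tinv q (m + 2) (m + 1)) =
      Tr (m + 1) (jucysMurphy q (m + 1) ^ (j + 1) * T q (m + 2) (m + 1) *
        incl q (m + 1) (jucysMurphy q m ^ k) * Tinv q (m + 2) (m + 1)) -
      (q - q⁻¹) • (jucysMurphy q m ^ k *
        Tr (m + 1) (jucysMurphy q (m + 1) ^ j * T q (m + 2) (m + 1)) * jucysMurphy q m) := by
  have hT : ∀ X : HeckeAlgebra q (m + 2), X * Tinv q (m + 2) (m + 1) =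
      X * T q (m + 2) (m + 1) - (q - q⁻¹) • X := fun X => by
    rw [Tinv, mul_sub, ← Algebra.commutes, ← Algebra.smul_def]
  have hc : Commute (jucysMurphy q (m + 1) ^ (j + 1)) (incl q (m + 1) (jucysMurphy q m ^ k)) :=
    (jucysMurphy_commute_incl (m + 1) _).pow_left _
  rw [← h.mul_left, ← h.mul_right, ← map_smul, ← map_sub]
  congr 1
  have e := jucysMurphy_succ_mul_Tinv (q := q) m
  rw [pow_succ' (jucysMurphy q m) k, map_mul]
  calc _ = jucysMurphy q (m + 1) ^ j * (T q (m + 2) (m + 1) * incl q (m + 1) (jucysMurphy q m)) *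
        incl q (m + 1) (jucysMurphy q m ^ k) * Tinv q (m + 2) (m + 1) := by
          simp only [mul_assoc]
    _ = jucysMurphy q (m + 1) ^ (j + 1) * Tinv q (m + 2) (m + 1) *
        incl q (m + 1) (jucysMurphy q m ^ k) * Tinv q (m + 2) (m + 1) := by
          rw [← e, pow_succ]; simp only [mul_assoc]
    _ = jucysMurphy q (m + 1) ^ (j + 1) * T q (m + 2) (m + 1) *
        incl q (m + 1) (jucysMurphy q m ^ k) * Tinv q (m + 2) (m + 1) -
        (q - q⁻¹) • (jucysMurphy q (m + 1) ^ (j + 1) *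
        incl q (m + 1) (jucysMurphy q m ^ k) * Tinv q (m + 2) (m + 1)) := by
          rw [hT (jucysMurphy q (m + 1) ^ (j + 1)), sub_mul, sub_mul, smul_mul_assoc,
            smul_mul_assoc]
    _ = _ := by
          rw [hc.eq, mul_assoc (incl q (m + 1) (jucysMurphy q m ^ k)), pow_succ,
            mul_assoc (jucysMurphy q (m + 1) ^ j) _ (Tinv q (m + 2) (m + 1)), e]
          simp only [mul_assoc]

/-- The partial trace of a power of `y'` minus that of the same power of `y`: iterating
`IsPartialTrace.conj_shift` turns `T y ^ k T⁻¹`, whose partial trace is known, into `y' ^ k`. -/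
theorem IsPartialTrace.jucysMurphy_pow (h : IsPartialTrace q Q Tr) (m k : ℕ) :
    Tr (m + 1) (jucysMurphy q (m + 1) ^ k) = incl q m (Tr m (jucysMurphy q m ^ k)) +
      (q - q⁻¹) • ∑ j ∈ Finset.range k, jucysMurphy q m ^ (k - 1 - j) *
        Tr (m + 1) (jucysMurphy q (m + 1) ^ j * T q (m + 2) (m + 1)) * jucysMurphy q m := by
  have key : ∀ i, i ≤ k → Tr (m + 1) (T q (m + 2) (m + 1) *
      incl q (m + 1) (jucysMurphy q m ^ k) * Tinv q (m + 2) (m + 1)) =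
      Tr (m + 1) (jucysMurphy q (m + 1) ^ i * T q (m + 2) (m + 1) *
        incl q (m + 1) (jucysMurphy q m ^ (k - i)) * Tinv q (m + 2) (m + 1)) -
      (q - q⁻¹) • ∑ j ∈ Finset.range i, jucysMurphy q m ^ (k - 1 - j) *
        Tr (m + 1) (jucysMurphy q (m + 1) ^ j * T q (m + 2) (m + 1)) * jucysMurphy q m := by
    intro i hi
    induction i with
    | zero => simp
    | succ i ih =>
      rw [ih (by omega), show k - i = k - (i + 1) + 1 by omega, h.conj_shift,
        Finset.sum_range_succ, smul_add, show k - 1 - i = k - (i + 1) by omega]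
      abel
  have := key k le_rfl
  rw [h.conj, Nat.sub_self, pow_zero, map_one, mul_one, mul_assoc,
    T_mul_Tinv (by omega) (by omega), mul_one] at this
  rw [this]
  abel

end Trace

/-! ### Lagrange interpolation and the weights of the added cells -/

section Interpolation

open Polynomial

/-- A monic polynomial whose degree is the number of nodes drops in degree after subtraction
of the nodal polynomial, and Lagrange interpolation gives the leading coefficient of the
difference. -/
theorem sum_eval_div_prod_sub {s : Finset ℕ} (hs : s.Nonempty) {x : ℕ → K}
    (hx : Set.InjOn x s) {P : K[X]} (hP : P.Monic) (hd : P.natDegree = s.card) :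
    ∑ i ∈ s, P.eval (x i) / ∏ j ∈ s.erase i, (x i - x j) = P.nextCoeff + ∑ i ∈ s, x i := by
  have hc : 0 < s.card := hs.card_pos
  set R : K[X] := ∏ i ∈ s, (X - C (x i)) with hR
  have hRm : R.Monic := monic_prod_X_sub_C x s
  have hRd : R.natDegree = s.card := natDegree_finsetProd_X_sub_C_eq_card s x
  have hdeg : (P - R).degree < s.card := by
    refine (degree_sub_lt_left ?_ hP.ne_zero ?_).trans_le ?_
    · rw [degree_eq_natDegree hP.ne_zero, degree_eq_natDegree hRm.ne_zero, hd, hRd]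
    · rw [hP.leadingCoeff, hRm.leadingCoeff]
    · rw [degree_eq_natDegree hP.ne_zero, hd]
  have h := Lagrange.coeff_eq_sum hx hdeg
  have e1 : P.coeff (s.card - 1) = P.nextCoeff := by
    rw [nextCoeff_of_natDegree_pos (by omega), hd]
  rw [coeff_sub, e1, hR, prod_X_sub_C_coeff_card_pred s x hc, sub_neg_eq_add] at h
  rw [h]
  refine Finset.sum_congr rfl fun i hi => ?_
  have : eval (x i) (∏ i ∈ s, (X - C (x i))) = 0 := by
    rw [eval_prod]; exact Finset.prod_eq_zero hi (by simp)
  rw [eval_sub, this, sub_zero]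

/-- Lagrange interpolation for `(P - a R) / X`, where `R` is the nodal polynomial and the constant
`a` makes the numerator divisible by `X`. -/
theorem sum_eval_div_mul_prod_sub {s : Finset ℕ} {x : ℕ → K}
    (hx : Set.InjOn x s) (h0 : ∀ i ∈ s, x i ≠ 0) {P : K[X]} (hP : P.Monic)
    (hd : P.natDegree = s.card) (hs : s.Nonempty) :
    ∑ i ∈ s, P.eval (x i) / x i / ∏ j ∈ s.erase i, (x i - x j) =
      1 - P.eval 0 / ∏ i ∈ s, -x i := by
  set R : K[X] := ∏ i ∈ s, (X - C (x i)) with hR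
  have hRm : R.Monic := monic_prod_X_sub_C x s
  have hRd : R.natDegree = s.card := natDegree_finsetProd_X_sub_C_eq_card s x
  have hR0 : R.eval 0 = ∏ i ∈ s, -x i := by simp [hR, eval_prod]
  have hR0' : R.eval 0 ≠ 0 := by
    rw [hR0]; exact Finset.prod_ne_zero_iff.mpr fun i hi => neg_ne_zero.mpr (h0 i hi)
  have hc : 0 < s.card := hs.card_pos
  set G : K[X] := P - C (P.eval 0 / R.eval 0) * R with hG
  have hG0 : G.coeff 0 = 0 := by
    rw [coeff_zero_eq_eval_zero, hG, eval_sub, eval_mul, eval_C, div_mul_cancel₀ _ hR0', sub_self]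
  have hXG : X * G.divX = G := by
    have := X_mul_divX_add G
    rwa [hG0, C_0, add_zero] at this
  have hGd : G.natDegree ≤ s.card := by
    refine (natDegree_sub_le _ _).trans (max_le hd.le ((natDegree_C_mul_le _ _).trans hRd.le))
  have hdeg : G.divX.degree < s.card := by
    refine lt_of_le_of_lt degree_le_natDegree ?_
    rw [natDegree_divX_eq_natDegree_tsub_one]
    exact_mod_cast (show G.natDegree - 1 < s.card by omega)
  have h := Lagrange.coeff_eq_sum hx hdeg
  have hcoeff : G.coeff s.card = 1 - P.eval 0 / R.eval 0 := by
    have e1 : P.coeff s.card = 1 := by rw [← hd]; exact hP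
    have e2 : R.coeff s.card = 1 := by rw [← hRd]; exact hRm
    rw [hG, coeff_sub, coeff_C_mul, e1, e2, mul_one]
  rw [coeff_divX, Nat.sub_add_cancel hc, hcoeff, hR0] at h
  rw [h]
  refine Finset.sum_congr rfl fun i hi => ?_
  congr 1
  have hRi : R.eval (x i) = 0 := by
    rw [hR, eval_prod]; exact Finset.prod_eq_zero hi (by simp)
  have : x i * G.divX.eval (x i) = P.eval (x i) := by
    have := congrArg (eval (x i)) hXG
    rwa [eval_mul, eval_X, hG, eval_sub, eval_mul, hRi, mul_zero, sub_zero] at this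
  rw [← this, mul_div_cancel_left₀ _ (h0 i hi)]

end Interpolation

/-- The part of the weight of the added cell in row `i` that does not depend on `Q`; it is the
ratio of two normalization factors.  Here `x s` is the `q`-content of the first cell after the end of
row `s`, and the rows are `0, …, N` with row `N` empty. -/
def hookFactor (q : K) (N : ℕ) (x : ℕ → K) (i : ℕ) : K :=
  (∏ s ∈ Finset.range N, (x i - (q ^ 2)⁻¹ * x s)) /
    ∏ s ∈ (Finset.range (N + 1)).erase i, (x i - x s)

/-- The weight of the cell added in row `i`, for rows with end contents `x`. -/
def weight (q Q : K) (N : ℕ) (x : ℕ → K) (i : ℕ) : K :=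
  ((q - q⁻¹) * Q + x i - 1) / ((q - q⁻¹) * x i) * hookFactor q N x i

/-- The `k`-th moment of the weights of all added cells, with respect to their `q`-contents. -/
def moment (q Q : K) (N : ℕ) (x : ℕ → K) (k : ℕ) : K :=
  ∑ i ∈ Finset.range (N + 1), weight q Q N x i * x i ^ k

open Polynomial in
/-- The monic polynomial of degree `N + 1` whose values at the nodes are the numerators of the
weights. -/
def weightPoly (q Q : K) (N : ℕ) (x : ℕ → K) : K[X] :=
  (X - C (1 - (q - q⁻¹) * Q)) * ∏ s ∈ Finset.range N, (X - C ((q ^ 2)⁻¹ * x s))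

section Moments

variable {N : ℕ} {x : ℕ → K}

theorem eval_weightPoly (z : K) : (weightPoly q Q N x).eval z =
    ((q - q⁻¹) * Q + z - 1) * ∏ s ∈ Finset.range N, (z - (q ^ 2)⁻¹ * x s) := by
  simp only [weightPoly, Polynomial.eval_mul, Polynomial.eval_prod, Polynomial.eval_sub,
    Polynomial.eval_X, Polynomial.eval_C]
  ring

theorem weightPoly_monic : (weightPoly q Q N x).Monic :=
  (Polynomial.monic_X_sub_C _).mul (Polynomial.monic_prod_X_sub_C _ _)

theorem natDegree_weightPoly :
    (weightPoly q Q N x).natDegree = (Finset.range (N + 1)).card := by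
  rw [weightPoly, (Polynomial.monic_X_sub_C _).natDegree_mul (Polynomial.monic_prod_X_sub_C _ _),
    Polynomial.natDegree_X_sub_C, Polynomial.natDegree_finsetProd_X_sub_C_eq_card]
  simp [add_comm]

theorem nextCoeff_weightPoly : (weightPoly q Q N x).nextCoeff =
    (q - q⁻¹) * Q - 1 - (q ^ 2)⁻¹ * ∑ s ∈ Finset.range N, x s := by
  rw [weightPoly, (Polynomial.monic_X_sub_C _).nextCoeff_mul (Polynomial.monic_prod_X_sub_C _ _),
    Polynomial.nextCoeff_X_sub_C, Polynomial.prod_X_sub_C_nextCoeff, Finset.mul_sum]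
  ring

theorem weight_eq (i : ℕ) : weight q Q N x i = (q - q⁻¹)⁻¹ *
    ((weightPoly q Q N x).eval (x i) / x i /
      ∏ j ∈ (Finset.range (N + 1)).erase i, (x i - x j)) := by
  rw [weight, hookFactor, eval_weightPoly]
  simp only [div_eq_mul_inv, mul_inv]
  ring

theorem moment_zero (hq : q ≠ 0) (hk : q - q⁻¹ ≠ 0) (hx : Set.InjOn x (Finset.range (N + 1)))
    (h0 : ∀ i ∈ Finset.range (N + 1), x i ≠ 0) (hN : x N = ((q ^ 2)⁻¹) ^ N) :
    moment q Q N x 0 = Q := by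
  simp only [moment, pow_zero, mul_one, weight_eq]
  rw [← Finset.mul_sum, sum_eval_div_mul_prod_sub hx h0 weightPoly_monic natDegree_weightPoly
    ⟨0, by simp⟩, eval_weightPoly]
  have h1 : ∏ i ∈ Finset.range N, -x i ≠ 0 := Finset.prod_ne_zero_iff.mpr fun i hi =>
    neg_ne_zero.mpr (h0 i (by simp at hi ⊢; omega))
  have h2 : ∏ s ∈ Finset.range N, (0 - (q ^ 2)⁻¹ * x s) =
      ((q ^ 2)⁻¹) ^ N * ∏ i ∈ Finset.range N, -x i := by
    simp only [zero_sub, ← mul_neg, Finset.prod_mul_distrib, Finset.prod_const, Finset.card_range]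
  have h3 : ((q ^ 2)⁻¹) ^ N ≠ 0 := pow_ne_zero _ (inv_ne_zero (pow_ne_zero _ hq))
  rw [Finset.prod_range_succ, h2, hN]
  generalize ∏ i ∈ Finset.range N, -x i = p at *
  generalize ((q ^ 2)⁻¹) ^ N = r at *
  generalize q - q⁻¹ = κ at *
  field_simp
  ring

theorem moment_one (hx : Set.InjOn x (Finset.range (N + 1)))
    (h0 : ∀ i ∈ Finset.range (N + 1), x i ≠ 0) :
    moment q Q N x 1 = (q - q⁻¹)⁻¹ * ((q - q⁻¹) * Q - 1 -
      (q ^ 2)⁻¹ * ∑ s ∈ Finset.range N, x s + ∑ s ∈ Finset.range (N + 1), x s) := by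
  rw [← nextCoeff_weightPoly, ← sum_eval_div_prod_sub ⟨0, by simp⟩ hx weightPoly_monic
    natDegree_weightPoly, Finset.mul_sum, moment]
  refine Finset.sum_congr rfl fun i hi => ?_
  have := h0 i hi
  rw [weight_eq, pow_one]
  field_simp

theorem weight_eq_zero {i s : ℕ} (hs : s < N) (h : x i = (q ^ 2)⁻¹ * x s) :
    weight q Q N x i = 0 := by
  rw [weight, hookFactor, Finset.prod_eq_zero (Finset.mem_range.mpr hs) (by rw [h, sub_self]),
    zero_div, mul_zero]

section Step

variable {c : ℕ}

/-- The effect on the weight in row `i` of a cell added in another row `c`. -/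
theorem weight_update (hq : q ≠ 0) (hc : c < N) (hx : Set.InjOn x (Finset.range (N + 1)))
    (hx' : Set.InjOn (Function.update x c (q ^ 2 * x c)) (Finset.range (N + 1))) {i : ℕ}
    (hi : i ∈ Finset.range (N + 1)) (hne : i ≠ c) :
    weight q Q N (Function.update x c (q ^ 2 * x c)) i *
        ((x i - q ^ 2 * x c) * (x i - (q ^ 2)⁻¹ * x c)) =
      weight q Q N x i * (x i - x c) ^ 2 := by
  have hcN : c ∈ Finset.range N := Finset.mem_range.mpr hc
  have hcN' : c ∈ Finset.range (N + 1) := by simp; omega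
  have hce : c ∈ (Finset.range (N + 1)).erase i := Finset.mem_erase.mpr ⟨hne.symm, hcN'⟩
  have d1 : x i - x c ≠ 0 := sub_ne_zero.mpr fun h => hne (hx hi hcN' h)
  have d2 : x i - q ^ 2 * x c ≠ 0 := sub_ne_zero.mpr fun h => hne (hx' hi hcN' (by simp [hne, h]))
  have q2 : (q ^ 2)⁻¹ * (q ^ 2 * x c) = x c := inv_mul_cancel_left₀ (pow_ne_zero _ hq) _
  have e1 : ∏ s ∈ (Finset.range N).erase c,
      (x i - (q ^ 2)⁻¹ * Function.update x c (q ^ 2 * x c) s) =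
      ∏ s ∈ (Finset.range N).erase c, (x i - (q ^ 2)⁻¹ * x s) :=
    Finset.prod_congr rfl fun s hs => by rw [Function.update_of_ne (Finset.ne_of_mem_erase hs)]
  have e2 : ∏ s ∈ ((Finset.range (N + 1)).erase i).erase c,
      (x i - Function.update x c (q ^ 2 * x c) s) =
      ∏ s ∈ ((Finset.range (N + 1)).erase i).erase c, (x i - x s) :=
    Finset.prod_congr rfl fun s hs => by rw [Function.update_of_ne (Finset.ne_of_mem_erase hs)]
  rw [weight, weight, hookFactor, hookFactor, Function.update_of_ne hne,
    ← Finset.mul_prod_erase _ _ hcN, ← Finset.mul_prod_erase _ _ hce,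
    ← Finset.mul_prod_erase (Finset.range N) (fun s => x i - (q ^ 2)⁻¹ * x s) hcN,
    ← Finset.mul_prod_erase _ (fun s => x i - x s) hce, e1, e2, Function.update_self, q2]
  simp only [div_eq_mul_inv, mul_inv]
  generalize (∏ s ∈ ((Finset.range (N + 1)).erase i).erase c, (x i - x s))⁻¹ = B
  generalize ∏ s ∈ (Finset.range N).erase c, (x i - (q ^ 2)⁻¹ * x s) = A
  generalize x i - (q ^ 2)⁻¹ * x c = e
  field_simp

theorem moment_update_succ_succ (hq : q ≠ 0) (hc : c < N)
    (hx : Set.InjOn x (Finset.range (N + 1)))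
    (hx' : Set.InjOn (Function.update x c (q ^ 2 * x c)) (Finset.range (N + 1))) (k : ℕ) :
    moment q Q N (Function.update x c (q ^ 2 * x c)) (k + 2) -
        (q ^ 2 + (q ^ 2)⁻¹) * x c * moment q Q N (Function.update x c (q ^ 2 * x c)) (k + 1) +
        x c ^ 2 * moment q Q N (Function.update x c (q ^ 2 * x c)) k =
      moment q Q N x (k + 2) - 2 * x c * moment q Q N x (k + 1) + x c ^ 2 * moment q Q N x k := by
  simp only [moment, Finset.mul_sum, ← Finset.sum_sub_distrib, ← Finset.sum_add_distrib]
  refine Finset.sum_congr rfl fun i hi => ?_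
  have hq2 : q ^ 2 * (q ^ 2)⁻¹ = 1 := mul_inv_cancel₀ (pow_ne_zero _ hq)
  rcases eq_or_ne i c with rfl | hne
  · rw [Function.update_self]
    generalize (q ^ 2)⁻¹ = r at *
    linear_combination (-weight q Q N (Function.update x i (q ^ 2 * x i)) i *
      (q ^ 2 * x i) ^ k * x i ^ 2) * hq2
  · have h := weight_update (Q := Q) hq hc hx hx' hi hne
    rw [Function.update_of_ne hne]
    generalize (q ^ 2)⁻¹ = r at *
    linear_combination x i ^ k * h - (weight q Q N (Function.update x c (q ^ 2 * x c)) i *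
      x i ^ k * x c ^ 2) * hq2

theorem moment_update_one (hq : q ≠ 0) (hk : q - q⁻¹ ≠ 0) (hc : c < N)
    (hx : Set.InjOn x (Finset.range (N + 1)))
    (hx' : Set.InjOn (Function.update x c (q ^ 2 * x c)) (Finset.range (N + 1)))
    (h0 : ∀ i ∈ Finset.range (N + 1), x i ≠ 0) :
    moment q Q N (Function.update x c (q ^ 2 * x c)) 1 =
      moment q Q N x 1 + (q - q⁻¹) * x c := by
  have hcN : c ∈ Finset.range N := Finset.mem_range.mpr hc
  have hcN' : c ∈ Finset.range (N + 1) := by simp; omega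
  have h0' : ∀ i ∈ Finset.range (N + 1), Function.update x c (q ^ 2 * x c) i ≠ 0 := by
    intro i hi
    rcases eq_or_ne i c with rfl | hne
    · rw [Function.update_self]; exact mul_ne_zero (pow_ne_zero _ hq) (h0 i hi)
    · rw [Function.update_of_ne hne]; exact h0 i hi
  have e : ∀ s : Finset ℕ, c ∈ s → ∑ i ∈ s, Function.update x c (q ^ 2 * x c) i =
      ∑ i ∈ s, x i + (q ^ 2 - 1) * x c := by
    intro s hs
    rw [Finset.sum_update_of_mem hs, ← Finset.add_sum_erase _ _ hs, Finset.erase_eq]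
    ring
  rw [moment_one hx h0, moment_one hx' h0', e _ hcN, e _ hcN']
  have : (q ^ 2 - 1) * (1 - (q ^ 2)⁻¹) = (q - q⁻¹) * (q - q⁻¹) := by field_simp
  generalize q - q⁻¹ = κ at *
  generalize (q ^ 2)⁻¹ = r at *
  field_simp
  linear_combination x c * this

end Step
end Moments

/-! ### Growths and the subalgebra of Jucys--Murphy elements -/

/-- A list of rows is a growth if cells can be added in these rows, from the last entry of the list
to the first, such that all intermediate shapes are diagrams.  The shape itself is encoded by the
list: row `i` has as many cells as `i` has occurrences.  Growths are the same as standard tableaux. -/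
def IsGrowth : List ℕ → Prop
  | [] => True
  | i :: p => IsGrowth p ∧ (i = 0 ∨ p.count i < p.count (i - 1))

/-- The `q`-content of the first cell after the end of row `i` of the shape of a list of rows. -/
def node (q : K) (p : List ℕ) (i : ℕ) : K := q ^ (2 * ((p.count i : ℤ) - i))

theorem IsGrowth.antitone {p : List ℕ} (h : IsGrowth p) : Antitone fun i => p.count i := by
  refine antitone_nat_of_succ_le fun i => ?_
  induction p with
  | nil => simp
  | cons c p ih =>
    have h1 := ih h.1
    have h2 := h.2
    simp only [List.count_cons, beq_iff_eq]
    rcases eq_or_ne c (i + 1) with rfl | hc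
    · simp at h2 ⊢; omega
    · split_ifs <;> omega

theorem IsGrowth.lt_length {p : List ℕ} (h : IsGrowth p) {i : ℕ} (hi : 0 < p.count i) :
    i < p.length := by
  induction p generalizing i with
  | nil => simp at hi
  | cons c p ih =>
    have h2 := h.2
    simp only [List.length_cons]
    rcases eq_or_ne c i with rfl | hc
    · rcases h2 with rfl | h2
      · omega
      · have := ih h.1 (i := c - 1) (by omega)
        omega
    · rw [List.count_cons_of_ne hc] at hi
      have := ih h.1 hi
      omega

theorem IsGrowth.head_le_length {p : List ℕ} {i : ℕ} (h : IsGrowth (i :: p)) : i ≤ p.length := by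
  rcases h.2 with rfl | h2
  · omega
  · have := h.1.lt_length (i := i - 1) (by omega)
    omega

theorem node_cons (hq : q ≠ 0) (c : ℕ) (p : List ℕ) :
    node q (c :: p) = Function.update (node q p) c (q ^ 2 * node q p c) := by
  funext i
  rcases eq_or_ne i c with rfl | hne
  · rw [Function.update_self, node, node, List.count_cons_self, ← zpow_natCast, ← zpow_add₀ hq]
    congr 1
    push_cast
    ring
  · rw [Function.update_of_ne hne, node, node, List.count_cons_of_ne hne.symm]

theorem node_ne_zero (hq : q ≠ 0) (p : List ℕ) (i : ℕ) : node q p i ≠ 0 := zpow_ne_zero _ hq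

theorem zpow_injective_of_ne_one (hq : q ≠ 0) (hq1 : ∀ d : ℤ, d ≠ 0 → q ^ d ≠ 1) :
    Function.Injective fun d : ℤ => q ^ d := by
  intro a b h
  by_contra hne
  refine hq1 (a - b) (sub_ne_zero.mpr hne) ?_
  rw [zpow_sub₀ hq]
  exact (div_eq_one_iff_eq (zpow_ne_zero _ hq)).mpr h

theorem sub_inv_ne_zero (hq : q ≠ 0) (hq1 : ∀ d : ℤ, d ≠ 0 → q ^ d ≠ 1) : q - q⁻¹ ≠ 0 := by
  intro h
  have := zpow_injective_of_ne_one hq hq1 (a₁ := 1) (a₂ := -1)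
    (by simpa [zpow_neg] using sub_eq_zero.mp h)
  omega

theorem IsGrowth.node_injective (hq : q ≠ 0) (hq1 : ∀ d : ℤ, d ≠ 0 → q ^ d ≠ 1) {p : List ℕ}
    (h : IsGrowth p) : Function.Injective (node q p) := by
  intro i j hij
  have := zpow_injective_of_ne_one hq hq1 hij
  rcases lt_trichotomy i j with h' | h' | h'
  · have := h.antitone h'.le
    simp only at this; omega
  · exact h'
  · have := h.antitone h'.le
    simp only at this; omega

theorem IsGrowth.node_length {p : List ℕ} (h : IsGrowth p) {N : ℕ}
    (hN : p.length ≤ N) : node q p N = ((q ^ 2)⁻¹) ^ N := by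
  have : p.count N = 0 := by
    by_contra h0
    have := h.lt_length (Nat.pos_of_ne_zero h0)
    omega
  rw [node, this, ← zpow_natCast, inv_zpow', ← zpow_natCast, ← zpow_mul]
  congr 1
  push_cast
  ring

/-- If no cell can be added in row `i`, then row `i - 1` has the same length and its factor in the
numerator of the weight vanishes. -/
theorem IsGrowth.weight_eq_zero (hq : q ≠ 0) {p : List ℕ} (h : IsGrowth p) {N i : ℕ} (hi : i ≤ N)
    (hn : ¬ IsGrowth (i :: p)) : weight q Q N (node q p) i = 0 := by
  have h1 : ¬ (i = 0 ∨ p.count i < p.count (i - 1)) := fun h' => hn ⟨h, h'⟩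
  push Not at h1
  have h2 := h.antitone (Nat.sub_le i 1)
  simp only at h2
  refine Hecke.weight_eq_zero (s := i - 1) (by omega) ?_
  rw [node, node, show p.count i = p.count (i - 1) by omega, ← zpow_natCast, ← zpow_neg,
    ← zpow_add₀ hq]
  congr 1
  push_cast [Nat.cast_sub (show 1 ≤ i by omega)]
  ring

/-- The weighted sum of the values of a function at all prolongations of a list by one row.  Lists
that are not growths are kept: they are reached with weight zero only. -/
def growthStep (q Q : K) (N : ℕ) : (List ℕ → K) →ₗ[K] (List ℕ → K) where
  toFun f p := ∑ i ∈ Finset.range (N + 1), weight q Q N (node q p) i * f (i :: p)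
  map_add' f g := by
    funext p
    simp only [Pi.add_apply, mul_add, Finset.sum_add_distrib]
  map_smul' a f := by
    funext p
    simp only [Pi.smul_apply, smul_eq_mul, RingHom.id_apply, Finset.mul_sum]
    exact Finset.sum_congr rfl fun _ _ => by ring

/-- The weighted sum of the values of a function at the growths of length `m`. -/
def growthSum (q Q : K) (N : ℕ) : ℕ → (List ℕ → K) →ₗ[K] K
  | 0 => LinearMap.proj []
  | m + 1 => (growthSum q Q N m).comp (growthStep q Q N)

theorem growthStep_apply (N : ℕ) (f : List ℕ → K) (p : List ℕ) : growthStep q Q N f p =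
    ∑ i ∈ Finset.range (N + 1), weight q Q N (node q p) i * f (i :: p) := rfl

theorem growthSum_congr (hq : q ≠ 0) {N m : ℕ} {f g : List ℕ → K}
    (h : ∀ p, IsGrowth p → p.length = m → f p = g p) :
    growthSum q Q N m f = growthSum q Q N m g := by
  induction m generalizing f g with
  | zero => exact h [] trivial rfl
  | succ m ih =>
    refine ih fun p hp hl => ?_
    rw [growthStep_apply, growthStep_apply]
    refine Finset.sum_congr rfl fun i hi => ?_
    by_cases hg : IsGrowth (i :: p)
    · rw [h _ hg (by simp [hl])]
    · rw [hp.weight_eq_zero hq (by simp at hi; omega) hg, zero_mul, zero_mul]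

/-- The `q`-content of the last cell added in a list of rows; the value at the empty list is not
used. -/
def headNode (q : K) : List ℕ → K
  | [] => 0
  | i :: p => node q p i

/-- The embedding of `H_m` into `H_{m+1}`, together with the pullback of functions on lists of rows
along the removal of the last cell. -/
def symbolIncl (q : K) (m : ℕ) :
    (HeckeAlgebra q m × (List ℕ → K)) →ₐ[K] (HeckeAlgebra q (m + 1) × (List ℕ → K)) :=
  (incl q m).prodMap (AlgHom.pi fun p => Pi.evalAlgHom K _ p.tail)

/-- The pairs of a polynomial in `y_1, …, y_m`, as an element of `H_m`, and the function on lists of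
rows that evaluates the same polynomial at the `q`-contents of the cells.  Working with pairs avoids
the choice of a polynomial. -/
def symbolAlgebra (q : K) : ∀ m : ℕ, Subalgebra K (HeckeAlgebra q m × (List ℕ → K))
  | 0 => ⊥
  | m + 1 => Algebra.adjoin K
      (symbolIncl q m '' symbolAlgebra q m ∪ {(jucysMurphy q m, headNode q)})

theorem symbolIncl_mem {m : ℕ} {z : HeckeAlgebra q m × (List ℕ → K)}
    (hz : z ∈ symbolAlgebra q m) : symbolIncl q m z ∈ symbolAlgebra q (m + 1) :=
  Algebra.subset_adjoin (Or.inl ⟨z, hz, rfl⟩)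

theorem jucysMurphy_mem (m : ℕ) : (jucysMurphy q m, headNode q) ∈ symbolAlgebra q (m + 1) :=
  Algebra.subset_adjoin (Or.inr rfl)

/-- A polynomial in `y_1, …, y_{m+1}` is a combination of powers of `y_{m+1}` with coefficients
polynomial in `y_1, …, y_m`, because `y_{m+1}` commutes with `H_m`. -/
theorem mem_span_of_mem_symbolAlgebra {m : ℕ} {z : HeckeAlgebra q (m + 1) × (List ℕ → K)}
    (hz : z ∈ symbolAlgebra q (m + 1)) :
    z ∈ Submodule.span K {w | ∃ r ∈ symbolAlgebra q m, ∃ k : ℕ,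
      w = symbolIncl q m r * (jucysMurphy q m, headNode q) ^ k} := by
  set S := {w | ∃ r ∈ symbolAlgebra q m, ∃ k : ℕ,
      w = symbolIncl q m r * (jucysMurphy q m, headNode q) ^ k}
  suffices h : ∀ w ∈ Submodule.span K S, z * w ∈ Submodule.span K S by
    simpa using h 1 (Submodule.subset_span ⟨1, one_mem _, 0, by simp⟩)
  induction hz using Algebra.adjoin_induction with
  | mem z hz =>
    intro w hw
    induction hw using Submodule.span_induction with
    | zero => rw [mul_zero]; exact zero_mem _
    | add u v _ _ hu hv => rw [mul_add]; exact add_mem hu hv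
    | smul a u _ hu => rw [mul_smul_comm]; exact Submodule.smul_mem _ _ hu
    | mem w hw =>
      obtain ⟨r, hr, k, rfl⟩ := hw
      refine Submodule.subset_span ?_
      rcases hz with ⟨r', hr', rfl⟩ | rfl
      · exact ⟨r' * r, mul_mem hr' hr, k, by rw [map_mul, mul_assoc]⟩
      · refine ⟨r, hr, k + 1, ?_⟩
        have : Commute (jucysMurphy q m, headNode q) (symbolIncl q m r) :=
          Prod.ext (jucysMurphy_commute_incl m r.1).eq (mul_comm _ _)
        rw [← mul_assoc, this.eq, mul_assoc, pow_succ']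
  | algebraMap a =>
    intro w hw
    rw [← Algebra.smul_def]
    exact Submodule.smul_mem _ _ hw
  | add u v _ _ hu hv => intro w hw; rw [add_mul]; exact add_mem (hu w hw) (hv w hw)
  | mul u v _ _ hu hv => intro w hw; rw [mul_assoc]; exact hu _ (hv w hw)

section Moments

variable {N : ℕ}

theorem moment_node_nil (hq : q ≠ 0) (hq1 : ∀ d : ℤ, d ≠ 0 → q ^ d ≠ 1) (k : ℕ) :
    moment q Q N (node q []) k = Q := by
  have hg : IsGrowth [] := trivial
  refine Eq.trans ?_ (moment_zero (q := q) (Q := Q) (N := N) hq (sub_inv_ne_zero hq hq1)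
    (hg.node_injective hq hq1).injOn (fun i _ => node_ne_zero hq [] i)
    (hg.node_length (Nat.zero_le N)))
  refine Finset.sum_congr rfl fun i hi => ?_
  rcases eq_or_ne i 0 with rfl | h0
  · simp [node]
  · rw [hg.weight_eq_zero hq (by simp at hi; omega) (by simp [IsGrowth, h0]), zero_mul, zero_mul]

/-- The partial trace of a power of `y_{m+1}` is a polynomial in `y_1, …, y_m` that takes the moments
of the weights as its values at growths. -/
theorem exists_moment_mem (hq : q ≠ 0) (hq1 : ∀ d : ℤ, d ≠ 0 → q ^ d ≠ 1) {m : ℕ} (hm : m < N)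
    (k : ℕ) : ∃ g, (partialTrace q Q m (jucysMurphy q m ^ k), g) ∈ symbolAlgebra q m ∧
      ∀ p, IsGrowth p → p.length = m → g p = moment q Q N (node q p) k := by
  have hTr := isPartialTrace_partialTrace q Q
  have hκ := sub_inv_ne_zero hq hq1
  induction m generalizing k with
  | zero =>
    refine ⟨fun _ => Q, ?_, fun p _ hl => ?_⟩
    · have := hTr.scalar 0 1
      rw [map_one] at this
      rw [jucysMurphy, one_pow, this, ← Algebra.algebraMap_eq_smul_one]
      exact (symbolAlgebra q 0).algebraMap_mem Q
    · rw [List.length_eq_zero_iff] at hl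
      rw [hl, moment_node_nil hq hq1]
  | succ m ih =>
    set Tr := partialTrace q Q with hTrdef
    set b : ℕ → HeckeAlgebra q (m + 1) := fun k =>
      Tr (m + 1) (jucysMurphy q (m + 1) ^ k * T q (m + 2) (m + 1)) with hb
    set a : ℕ → HeckeAlgebra q (m + 1) := fun k => Tr (m + 1) (jucysMurphy q (m + 1) ^ k) with ha
    set d : ℕ → HeckeAlgebra q (m + 1) := fun k => ∑ j ∈ Finset.range k,
      jucysMurphy q m ^ (k - 1 - j) * b j * jucysMurphy q m with hd
    have hb0 : b 0 = 1 := by simp only [hb, pow_zero, one_mul]; exact hTr.gen m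
    have hbs : ∀ k, b (k + 1) = b k * jucysMurphy q m + (q - q⁻¹) • a (k + 1) :=
      hTr.jucysMurphy_pow_succ_mul_T m
    have hak : ∀ k, a k = incl q m (Tr m (jucysMurphy q m ^ k)) + (q - q⁻¹) • d k :=
      hTr.jucysMurphy_pow m
    have hds : ∀ k, d (k + 1) = jucysMurphy q m * d k + b k * jucysMurphy q m := by
      intro k
      simp only [hd]
      rw [Finset.sum_range_succ, Finset.mul_sum, show k + 1 - 1 - k = 0 by omega, pow_zero,
        one_mul]
      congr 1
      refine Finset.sum_congr rfl fun j hj => ?_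
      have := Finset.mem_range.mp hj
      rw [show k + 1 - 1 - j = (k - 1 - j) + 1 by omega, pow_succ']
      simp only [mul_assoc]
    have hinj : ∀ {p}, IsGrowth p → Set.InjOn (node q p) (Finset.range (N + 1)) :=
      fun hp => (hp.node_injective hq hq1).injOn
    -- the recursion for the moments when a cell is added
    have hrec : ∀ c p, IsGrowth (c :: p) → p.length = m →
        moment q Q N (node q (c :: p)) 0 = moment q Q N (node q p) 0 ∧
        moment q Q N (node q (c :: p)) 1 =
          moment q Q N (node q p) 1 + (q - q⁻¹) * node q p c ∧
        ∀ k, moment q Q N (node q (c :: p)) (k + 2) -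
          (q ^ 2 + (q ^ 2)⁻¹) * node q p c * moment q Q N (node q (c :: p)) (k + 1) +
          node q p c ^ 2 * moment q Q N (node q (c :: p)) k =
          moment q Q N (node q p) (k + 2) - 2 * node q p c * moment q Q N (node q p) (k + 1) +
          node q p c ^ 2 * moment q Q N (node q p) k := by
      intro c p hp hl
      have hc : c < N := by have := hp.head_le_length; omega
      have h1 := hinj hp.1
      have h2 := hinj hp
      refine ⟨?_, ?_, fun k => ?_⟩
      · rw [moment_zero hq hκ h1 (fun i _ => node_ne_zero hq p i)
            (hp.1.node_length (by omega)),
          moment_zero hq hκ h2 (fun i _ => node_ne_zero hq _ i)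
            (hp.node_length (by simp; omega))]
      · rw [node_cons hq] at h2 ⊢
        exact moment_update_one hq hκ hc h1 h2 fun i _ => node_ne_zero hq p i
      · rw [node_cons hq] at h2 ⊢
        exact moment_update_succ_succ hq hc h1 h2 k
    have hκ2 : (q - q⁻¹) * (q - q⁻¹) = q ^ 2 + (q ^ 2)⁻¹ - 2 := by field_simp; ring
    -- the values of `d k` and `b k` are described after multiplication with `κ` and `κ y`, which
    -- makes all three claims linear in the moments
    suffices H : ∀ k, (∃ g, (a k, g) ∈ symbolAlgebra q (m + 1) ∧ ∀ c p, IsGrowth (c :: p) →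
          p.length = m → g (c :: p) = moment q Q N (node q (c :: p)) k) ∧
        (∃ g, (d k, g) ∈ symbolAlgebra q (m + 1) ∧ ∀ c p, IsGrowth (c :: p) →
          p.length = m → (q - q⁻¹) * g (c :: p) = moment q Q N (node q (c :: p)) k -
            moment q Q N (node q p) k) ∧
        (∃ g, (b k, g) ∈ symbolAlgebra q (m + 1) ∧ ∀ c p, IsGrowth (c :: p) →
          p.length = m → (q - q⁻¹) * node q p c * g (c :: p) =
            moment q Q N (node q (c :: p)) (k + 1) - moment q Q N (node q p) (k + 1) -
            node q p c * (moment q Q N (node q (c :: p)) k - moment q Q N (node q p) k)) by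
      obtain ⟨⟨g, hg, hg'⟩, -⟩ := H k
      refine ⟨g, hg, fun p hp hl => ?_⟩
      obtain ⟨c, p, rfl⟩ := List.exists_cons_of_length_eq_add_one hl
      exact hg' c p hp (by simpa using hl)
    have haOfD : ∀ k, (∃ g, (d k, g) ∈ symbolAlgebra q (m + 1) ∧ ∀ c p, IsGrowth (c :: p) →
          p.length = m → (q - q⁻¹) * g (c :: p) = moment q Q N (node q (c :: p)) k -
            moment q Q N (node q p) k) → ∃ g, (a k, g) ∈ symbolAlgebra q (m + 1) ∧
          ∀ c p, IsGrowth (c :: p) → p.length = m →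
            g (c :: p) = moment q Q N (node q (c :: p)) k := by
      rintro k ⟨gd, hgd, hgd'⟩
      obtain ⟨g, hg, hg'⟩ := ih (by omega) k
      rw [hak k]
      refine ⟨_, add_mem (symbolIncl_mem hg)
        (Subalgebra.smul_mem _ hgd (q - q⁻¹)), fun c p hp hl => ?_⟩
      change g p + (q - q⁻¹) * gd (c :: p) = _
      rw [hg' p hp.1 hl, hgd' c p hp hl]
      ring
    intro k
    induction k with
    | zero =>
      have hD : ∃ g, (d 0, g) ∈ symbolAlgebra q (m + 1) ∧ ∀ c p, IsGrowth (c :: p) →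
          p.length = m → (q - q⁻¹) * g (c :: p) = moment q Q N (node q (c :: p)) 0 -
            moment q Q N (node q p) 0 := by
        refine ⟨0, ?_, fun c p hp hl => ?_⟩
        · have : d 0 = 0 := by simp [hd]
          rw [this]; exact zero_mem _
        · rw [(hrec c p hp hl).1]; simp
      refine ⟨haOfD 0 hD, hD, 1, ?_, fun c p hp hl => ?_⟩
      · rw [hb0]; exact one_mem _
      · rw [(hrec c p hp hl).1, (hrec c p hp hl).2.1, Pi.one_apply]
        ring
    | succ k ihk =>
      obtain ⟨-, ⟨gd, hgd, hgd'⟩, gb, hgb, hgb'⟩ := ihk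
      have hD : ∃ g, (d (k + 1), g) ∈ symbolAlgebra q (m + 1) ∧ ∀ c p, IsGrowth (c :: p) →
          p.length = m → (q - q⁻¹) * g (c :: p) = moment q Q N (node q (c :: p)) (k + 1) -
            moment q Q N (node q p) (k + 1) := by
        rw [hds k]
        refine ⟨_, add_mem (mul_mem (jucysMurphy_mem m) hgd)
          (mul_mem hgb (jucysMurphy_mem m)), fun c p hp hl => ?_⟩
        have h1 := hgd' c p hp hl
        have h2 := hgb' c p hp hl
        change (q - q⁻¹) * (node q p c * gd (c :: p) + gb (c :: p) * node q p c) = _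
        linear_combination node q p c * h1 + h2
      obtain ⟨ga, hga, hga'⟩ := haOfD (k + 1) hD
      refine ⟨⟨ga, hga, hga'⟩, hD, ?_⟩
      rw [hbs k]
      refine ⟨_, add_mem (mul_mem hgb (jucysMurphy_mem m))
          (Subalgebra.smul_mem _ hga (q - q⁻¹)), fun c p hp hl => ?_⟩
      have h1 := hga' c p hp hl
      have h2 := hgb' c p hp hl
      have h3 := (hrec c p hp hl).2.2 k
      change (q - q⁻¹) * node q p c * (gb (c :: p) * node q p c + (q - q⁻¹) * ga (c :: p)) = _
      rw [h1]
      linear_combination node q p c * h2 - h3 +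
        node q p c * moment q Q N (node q (c :: p)) (k + 1) * hκ2

/-- The Ocneanu--Markov trace of a polynomial in the Jucys--Murphy elements is the weighted sum of
its values at the contents of all growths. -/
theorem ocneanuTrace_eq_growthSum (hq : q ≠ 0) (hq1 : ∀ d : ℤ, d ≠ 0 → q ^ d ≠ 1) {m : ℕ}
    (hm : m ≤ N) {x : HeckeAlgebra q m} {f : List ℕ → K} (h : (x, f) ∈ symbolAlgebra q m) :
    ocneanuTrace q Q m x = growthSum q Q N m f := by
  have hTr := isPartialTrace_partialTrace q Q
  induction m generalizing f with
  | zero =>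
    obtain ⟨a, ha⟩ := Algebra.mem_bot.mp h
    obtain ⟨rfl, rfl⟩ := Prod.ext_iff.mp ha
    exact (zeroEquiv q).commutes a
  | succ m ih =>
    have hs := mem_span_of_mem_symbolAlgebra h
    suffices H : (ocneanuTrace q Q (m + 1)).comp (LinearMap.fst K _ _) (x, f) =
        (growthSum q Q N (m + 1)).comp (LinearMap.snd K _ _) (x, f) from H
    generalize (x, f) = z at hs
    induction hs using Submodule.span_induction with
    | zero => rw [map_zero, map_zero]
    | add u v _ _ hu hv => rw [map_add, map_add, hu, hv]
    | smul a u _ hu => rw [map_smul, map_smul, hu]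
    | mem w hw =>
      obtain ⟨⟨y, g⟩, hr, k, rfl⟩ := hw
      obtain ⟨μ, hμ, hμ'⟩ := exists_moment_mem (Q := Q) hq hq1 (show m < N by omega) k
      change ocneanuTrace q Q m (partialTrace q Q m (incl q m y * jucysMurphy q m ^ k)) =
        growthSum q Q N m (growthStep q Q N _)
      rw [hTr.mul_left, ih (by omega) (f := g * μ) (mul_mem hr hμ)]
      refine growthSum_congr hq fun p hp hl => ?_
      change g p * μ p = ∑ i ∈ Finset.range (N + 1), weight q Q N (node q p) i *
        (g p * node q p i ^ k)
      rw [hμ' p hp hl, moment, Finset.mul_sum]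
      exact Finset.sum_congr rfl fun i _ => by ring

end Moments

/-! ### Hook lengths -/

section Hooks

theorem qInt_ne_zero (hq : q ≠ 0) (hq1 : ∀ d : ℤ, d ≠ 0 → q ^ d ≠ 1) {d : ℤ} (hd : d ≠ 0) :
    qInt q d ≠ 0 := by
  refine div_ne_zero (fun h => ?_) (sub_inv_ne_zero hq hq1)
  have := zpow_injective_of_ne_one hq hq1 (sub_eq_zero.mp h)
  omega

theorem qInt_neg (d : ℤ) : qInt q (-d) = -qInt q d := by
  rw [qInt, qInt, neg_neg, ← neg_div, neg_sub]

/-- The product of the hook lengths in row `i` of the diagram formed by the rows above row `M`. -/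
theorem prod_qInt_truncatedHook (mu : YoungDiagram) (i M : ℕ) (hM : i < M) :
    (∏ j ∈ Finset.range (mu.rowLen i),
        qInt q ((mu.rowLen i : ℤ) + (min (mu.colLen j) M : ℕ) - i - j - 1)) *
      ∏ s ∈ Finset.Ioo i M, qInt q (((mu.rowLen i : ℤ) - i) - ((mu.rowLen s : ℤ) - s)) =
    ∏ j ∈ Finset.range (mu.rowLen i + M - 1 - i), qInt q ((j : ℤ) + 1) := by
  induction M, hM using Nat.le_induction with
  | base =>
    have e1 : Finset.Ioo i (i + 1) = ∅ := by ext; simp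
    rw [e1, Finset.prod_empty, mul_one, show mu.rowLen i + (i + 1) - 1 - i = mu.rowLen i by omega,
      ← Finset.prod_range_reflect (fun j : ℕ => qInt q ((j : ℤ) + 1))]
    refine Finset.prod_congr rfl fun j hj => ?_
    have hj' := Finset.mem_range.mp hj
    have hc : i < mu.colLen j :=
      YoungDiagram.mem_iff_lt_colLen.mp (YoungDiagram.mem_iff_lt_rowLen.mpr hj')
    rw [min_eq_right (by omega)]
    congr 1
    omega
  | succ M hM ih =>
    have hle : mu.rowLen M ≤ mu.rowLen i := mu.rowLen_anti i M (by omega)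
    have e1 : Finset.Ioo i (M + 1) = insert M (Finset.Ioo i M) := by ext; simp; omega
    -- only the columns that meet row `M` change, and for those the product telescopes
    have hsplit : ∀ M', ∏ j ∈ Finset.range (mu.rowLen i),
        qInt q ((mu.rowLen i : ℤ) + (min (mu.colLen j) M' : ℕ) - i - j - 1) =
        (∏ j ∈ Finset.range (mu.rowLen M),
          qInt q ((mu.rowLen i : ℤ) + (min (mu.colLen j) M' : ℕ) - i - j - 1)) *
        ∏ j ∈ Finset.Ico (mu.rowLen M) (mu.rowLen i),
          qInt q ((mu.rowLen i : ℤ) + (min (mu.colLen j) M' : ℕ) - i - j - 1) :=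
      fun M' => (Finset.prod_range_mul_prod_Ico _ hle).symm
    have hcol : ∀ j ∈ Finset.range (mu.rowLen M), M < mu.colLen j := fun j hj =>
      YoungDiagram.mem_iff_lt_colLen.mp
        (YoungDiagram.mem_iff_lt_rowLen.mpr (Finset.mem_range.mp hj))
    have hnew : ∏ j ∈ Finset.range (mu.rowLen M),
        qInt q ((mu.rowLen i : ℤ) + (min (mu.colLen j) (M + 1) : ℕ) - i - j - 1) =
        ∏ j ∈ Finset.range (mu.rowLen M), qInt q ((mu.rowLen i : ℤ) + M - i - j) :=
      Finset.prod_congr rfl fun j hj => by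
        have := hcol j hj
        rw [min_eq_right (by omega)]
        congr 1
        omega
    have hold : ∏ j ∈ Finset.range (mu.rowLen M),
        qInt q ((mu.rowLen i : ℤ) + (min (mu.colLen j) M : ℕ) - i - j - 1) =
        ∏ j ∈ Finset.range (mu.rowLen M), qInt q ((mu.rowLen i : ℤ) + M - i - (j + 1 : ℕ)) :=
      Finset.prod_congr rfl fun j hj => by
        have := hcol j hj
        rw [min_eq_right (by omega)]
        congr 1
        omega
    have hrest : ∏ j ∈ Finset.Ico (mu.rowLen M) (mu.rowLen i),
        qInt q ((mu.rowLen i : ℤ) + (min (mu.colLen j) (M + 1) : ℕ) - i - j - 1) =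
        ∏ j ∈ Finset.Ico (mu.rowLen M) (mu.rowLen i),
          qInt q ((mu.rowLen i : ℤ) + (min (mu.colLen j) M : ℕ) - i - j - 1) := by
      refine Finset.prod_congr rfl fun j hj => ?_
      have hj' := (Finset.mem_Ico.mp hj).1
      have : mu.colLen j ≤ M := by
        by_contra h
        have := YoungDiagram.mem_iff_lt_rowLen.mp
          (YoungDiagram.mem_iff_lt_colLen.mpr (not_le.mp h))
        omega
      rw [min_eq_left (by omega), min_eq_left (by omega)]
    have htel := Finset.prod_range_succ (fun j : ℕ => qInt q ((mu.rowLen i : ℤ) + M - i - j))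
      (mu.rowLen M)
    rw [Finset.prod_range_succ', ← hold, ← hnew] at htel
    have g1 : ((mu.rowLen i : ℤ) - i) - ((mu.rowLen M : ℤ) - M) =
        (mu.rowLen i : ℤ) + M - i - mu.rowLen M := by ring
    have g2 : ((mu.rowLen i + M - 1 - i : ℕ) : ℤ) + 1 = (mu.rowLen i : ℤ) + M - i - (0 : ℕ) := by
      omega
    rw [e1, Finset.prod_insert (by simp), show mu.rowLen i + (M + 1) - 1 - i =
      mu.rowLen i + M - 1 - i + 1 by omega, Finset.prod_range_succ, ← ih, hsplit, hsplit, hrest,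
      g1, g2]
    linear_combination (-(∏ j ∈ Finset.Ico (mu.rowLen M) (mu.rowLen i),
      qInt q ((mu.rowLen i : ℤ) + (min (mu.colLen j) M : ℕ) - i - j - 1)) *
      ∏ s ∈ Finset.Ioo i M, qInt q (((mu.rowLen i : ℤ) - i) - ((mu.rowLen s : ℤ) - s))) * htel

/-- The contribution of row `i` to the normalization factor of the diagram with row lengths `r`, with
the hook lengths expressed by row lengths only; all rows from `N` on are empty. -/
def rowNorm (q : K) (N : ℕ) (r : ℕ → ℕ) (i : ℕ) : K :=
  (∏ j ∈ Finset.range (r i), q ^ ((j : ℤ) - i)) *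
    (∏ s ∈ Finset.Ioo i N, qInt q (((r i : ℤ) - i) - ((r s : ℤ) - s))) /
      ∏ j ∈ Finset.range (r i + N - 1 - i), qInt q ((j : ℤ) + 1)

theorem normFactor_eq_prod_rowNorm (hq : q ≠ 0) (hq1 : ∀ d : ℤ, d ≠ 0 → q ^ d ≠ 1)
    (mu : YoungDiagram) {N : ℕ} (hN : mu.rowLen N = 0) :
    normFactor q mu = ∏ i ∈ Finset.range N, rowNorm q N mu.rowLen i := by
  have hcol : ∀ j, mu.colLen j ≤ N := fun j => by
    by_contra h
    have := YoungDiagram.mem_iff_lt_rowLen.mp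
      (YoungDiagram.mem_iff_lt_colLen.mpr (not_le.mp h))
    omega
  have hcells : normFactor q mu = ∏ i ∈ Finset.range N, ∏ j ∈ Finset.range (mu.rowLen i),
      q ^ ((j : ℤ) - i) / qInt q (hook mu (i, j)) := by
    rw [Finset.prod_sigma', normFactor]
    refine Finset.prod_bij' (fun c _ => ⟨c.1, c.2⟩) (fun c _ => (c.1, c.2)) ?_ ?_ ?_ ?_ ?_
    · rintro ⟨i, j⟩ h
      have h1 := YoungDiagram.mem_iff_lt_rowLen.mp ((YoungDiagram.mem_cells _).mp h)
      have h2 := YoungDiagram.mem_iff_lt_colLen.mp ((YoungDiagram.mem_cells _).mp h)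
      have h3 := hcol j
      simp only [Finset.mem_sigma, Finset.mem_range]
      omega
    · rintro ⟨i, j⟩ h
      simp only [Finset.mem_sigma, Finset.mem_range] at h
      exact (YoungDiagram.mem_cells _).mpr (YoungDiagram.mem_iff_lt_rowLen.mpr h.2)
    · intros; rfl
    · intros; rfl
    · intros; rfl
  rw [hcells]
  refine Finset.prod_congr rfl fun i hi => ?_
  have h := prod_qInt_truncatedHook (q := q) mu i N (Finset.mem_range.mp hi)
  have hne : ∀ j ∈ Finset.range (mu.rowLen i), qInt q (hook mu (i, j)) ≠ 0 := by
    intro j hj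
    have h1 := Finset.mem_range.mp hj
    have h2 := YoungDiagram.mem_iff_lt_colLen.mp (YoungDiagram.mem_iff_lt_rowLen.mpr h1)
    refine qInt_ne_zero hq hq1 ?_
    simp only [hook]
    omega
  have e : ∏ j ∈ Finset.range (mu.rowLen i),
      qInt q ((mu.rowLen i : ℤ) + (min (mu.colLen j) N : ℕ) - i - j - 1) =
      ∏ j ∈ Finset.range (mu.rowLen i), qInt q (hook mu (i, j)) :=
    Finset.prod_congr rfl fun j _ => by rw [min_eq_left (hcol j)]; rfl
  rw [e] at h
  have hA := Finset.prod_ne_zero_iff.mpr hne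
  have hF : ∏ j ∈ Finset.range (mu.rowLen i + N - 1 - i), qInt q ((j : ℤ) + 1) ≠ 0 :=
    Finset.prod_ne_zero_iff.mpr fun j _ => qInt_ne_zero hq hq1 (by omega)
  rw [Finset.prod_div_distrib, rowNorm, div_eq_div_iff hA hF, ← h]
  ring

section Step

variable {N c : ℕ} {p : List ℕ}

theorem qInt_add_one_eq (hq : q ≠ 0) (i c : ℕ) (hne : node q p c ≠ node q p i) :
    qInt q ((((p.count c : ℤ) - c) - ((p.count i : ℤ) - i)) + 1) =
      qInt q (((p.count c : ℤ) - c) - ((p.count i : ℤ) - i)) *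
        (q * ((node q p c - (q ^ 2)⁻¹ * node q p i) / (node q p c - node q p i))) := by
  have hne' := sub_ne_zero.mpr hne
  rw [qInt, qInt, div_mul_eq_mul_div]
  congr 1
  simp only [node, two_mul, zpow_add₀ hq, zpow_sub₀ hq, neg_add, zpow_neg, zpow_one] at hne' ⊢
  have hu : q ^ (p.count c : ℤ) / q ^ (c : ℤ) ≠ 0 := div_ne_zero (zpow_ne_zero _ hq)
    (zpow_ne_zero _ hq)
  have hv : q ^ (p.count i : ℤ) / q ^ (i : ℤ) ≠ 0 := div_ne_zero (zpow_ne_zero _ hq)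
    (zpow_ne_zero _ hq)
  generalize q ^ (p.count c : ℤ) / q ^ (c : ℤ) = u at *
  generalize q ^ (p.count i : ℤ) / q ^ (i : ℤ) = v at *
  rw [← sq, ← sq] at hne'
  field_simp

/-- The normalization factor changes by `hookFactor` when a cell is added in row `c`. -/
theorem prod_rowNorm_cons (hq : q ≠ 0) (hq1 : ∀ d : ℤ, d ≠ 0 → q ^ d ≠ 1)
    (hp : IsGrowth (c :: p)) (hN : p.length < N) :
    ∏ i ∈ Finset.range N, rowNorm q N (fun i => (c :: p).count i) i =
      (∏ i ∈ Finset.range N, rowNorm q N (fun i => p.count i) i) *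
        hookFactor q N (node q p) c := by
  have hc : c < N := by have := hp.head_le_length; omega
  have hcN : c ∈ Finset.range N := Finset.mem_range.mpr hc
  have hinj := hp.1.node_injective hq hq1
  set ρ : ℕ → K := fun i =>
    q * ((node q p c - (q ^ 2)⁻¹ * node q p i) / (node q p c - node q p i)) with hρ
  have hcnt : ∀ i, i ≠ c → (c :: p).count i = p.count i := fun i hi =>
    List.count_cons_of_ne hi.symm
  -- rows below the new cell do not change
  have hgt : ∀ i, c < i → rowNorm q N (fun i => (c :: p).count i) i =
      rowNorm q N (fun i => p.count i) i := by
    intro i hi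
    have : ∏ s ∈ Finset.Ioo i N, qInt q ((((c :: p).count i : ℤ) - i) -
        (((c :: p).count s : ℤ) - s)) =
        ∏ s ∈ Finset.Ioo i N, qInt q (((p.count i : ℤ) - i) - ((p.count s : ℤ) - s)) :=
      Finset.prod_congr rfl fun s hs => by
        have := (Finset.mem_Ioo.mp hs).1
        rw [hcnt i (by omega), hcnt s (by omega)]
    simp only [rowNorm]
    rw [this, hcnt i (by omega)]
  -- a row above the new cell changes by a single factor
  have hlt : ∀ i, i < c → rowNorm q N (fun i => (c :: p).count i) i =
      rowNorm q N (fun i => p.count i) i * ρ i := by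
    intro i hi
    have hmem : c ∈ Finset.Ioo i N := Finset.mem_Ioo.mpr ⟨hi, hc⟩
    have h1 : ∏ s ∈ (Finset.Ioo i N).erase c, qInt q ((((c :: p).count i : ℤ) - i) -
        (((c :: p).count s : ℤ) - s)) =
        ∏ s ∈ (Finset.Ioo i N).erase c, qInt q (((p.count i : ℤ) - i) - ((p.count s : ℤ) - s)) :=
      Finset.prod_congr rfl fun s hs => by
        rw [hcnt i (by omega), hcnt s (Finset.ne_of_mem_erase hs)]
    have h2 := qInt_add_one_eq (q := q) (p := p) hq i c (fun h => by have := hinj h; omega)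
    have h3 : qInt q ((((c :: p).count i : ℤ) - i) - (((c :: p).count c : ℤ) - c)) =
        qInt q (((p.count i : ℤ) - i) - ((p.count c : ℤ) - c)) * ρ i := by
      rw [hcnt i (by omega), List.count_cons_self, ← neg_sub ((p.count c : ℤ) - c), qInt_neg,
        neg_mul, ← h2, ← qInt_neg]
      congr 1
      push_cast
      ring
    simp only [rowNorm]
    rw [← Finset.mul_prod_erase _ _ hmem, h1, h3, ← Finset.mul_prod_erase _
      (fun s => qInt q (((p.count i : ℤ) - i) - ((p.count s : ℤ) - s))) hmem, hcnt i (by omega)]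
    ring
  -- row `c` gains the power of `q` for the new cell and one factor of the factorial
  have heq : rowNorm q N (fun i => (c :: p).count i) c = rowNorm q N (fun i => p.count i) c *
      (q ^ ((p.count c : ℤ) - c) / qInt q ((p.count c : ℤ) - c + N) *
        ∏ s ∈ Finset.Ioo c N, ρ s) := by
    have h1 : ∏ s ∈ Finset.Ioo c N, qInt q ((((c :: p).count c : ℤ) - c) -
        (((c :: p).count s : ℤ) - s)) =
        (∏ s ∈ Finset.Ioo c N, qInt q (((p.count c : ℤ) - c) - ((p.count s : ℤ) - s))) *
          ∏ s ∈ Finset.Ioo c N, ρ s := by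
      rw [← Finset.prod_mul_distrib]
      refine Finset.prod_congr rfl fun s hs => ?_
      have hs' := (Finset.mem_Ioo.mp hs).1
      rw [← qInt_add_one_eq (q := q) (p := p) hq s c (fun h => by have := hinj h; omega),
        hcnt s (by omega), List.count_cons_self]
      congr 1
      push_cast
      ring
    simp only [rowNorm]
    rw [h1, List.count_cons_self, Finset.prod_range_succ,
      show p.count c + 1 + N - 1 - c = p.count c + N - 1 - c + 1 by omega,
      Finset.prod_range_succ, show ((p.count c + N - 1 - c : ℕ) : ℤ) + 1 = (p.count c : ℤ) - c + N
        by omega]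
    simp only [div_eq_mul_inv, mul_inv]
    ring
  have hprod : ∏ i ∈ (Finset.range N).erase c, rowNorm q N (fun i => (c :: p).count i) i =
      (∏ i ∈ (Finset.range N).erase c, rowNorm q N (fun i => p.count i) i) *
        ∏ i ∈ (Finset.range N).erase c, if i < c then ρ i else 1 := by
    rw [← Finset.prod_mul_distrib]
    refine Finset.prod_congr rfl fun i hi => ?_
    have := Finset.ne_of_mem_erase hi
    split_ifs with h
    · exact hlt i h
    · rw [mul_one]; exact hgt i (by omega)
  have hIoo : ∏ s ∈ Finset.Ioo c N, ρ s =
      ∏ i ∈ (Finset.range N).erase c, if i < c then 1 else ρ i := by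
    have : Finset.Ioo c N = ((Finset.range N).erase c).filter fun i => ¬ i < c := by
      ext i; simp; omega
    rw [this, Finset.prod_filter]
    exact Finset.prod_congr rfl fun i _ => by split_ifs <;> rfl
  have hcomb : (∏ i ∈ (Finset.range N).erase c, if i < c then ρ i else 1) *
      (∏ i ∈ (Finset.range N).erase c, if i < c then 1 else ρ i) =
      q ^ ((N : ℤ) - 1) * ((∏ i ∈ (Finset.range N).erase c,
        (node q p c - (q ^ 2)⁻¹ * node q p i)) /
          ∏ i ∈ (Finset.range N).erase c, (node q p c - node q p i)) := by
    rw [← Finset.prod_mul_distrib, ← Finset.prod_div_distrib]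
    have : q ^ ((N : ℤ) - 1) = ∏ i ∈ (Finset.range N).erase c, q := by
      rw [Finset.prod_const, Finset.card_erase_of_mem hcN, Finset.card_range, ← zpow_natCast,
        Nat.cast_sub (by omega), Nat.cast_one]
    rw [this, ← Finset.prod_mul_distrib]
    refine Finset.prod_congr rfl fun i _ => ?_
    split_ifs <;> simp [hρ]
  have hfac : hookFactor q N (node q p) c =
      q ^ ((p.count c : ℤ) - c) / qInt q ((p.count c : ℤ) - c + N) * (q ^ ((N : ℤ) - 1) *
        ((∏ i ∈ (Finset.range N).erase c, (node q p c - (q ^ 2)⁻¹ * node q p i)) /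
          ∏ i ∈ (Finset.range N).erase c, (node q p c - node q p i))) := by
    have e1 : (Finset.range (N + 1)).erase c = insert N ((Finset.range N).erase c) := by
      ext i; simp; omega
    have hne : node q p c - node q p N ≠ 0 := sub_ne_zero.mpr fun h => by
      have := hinj h; omega
    have hzero : p.count N = 0 := by
      by_contra h0
      have := hp.1.lt_length (Nat.pos_of_ne_zero h0)
      omega
    rw [hookFactor, e1, Finset.prod_insert (by simp), ← Finset.mul_prod_erase _ _ hcN,
      mul_div_mul_comm, ← mul_assoc]
    congr 1
    have hκ := sub_inv_ne_zero hq hq1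
    have hI := qInt_ne_zero hq hq1 (d := (p.count c : ℤ) - c + N) (by
      have := hc; omega)
    rw [div_mul_eq_mul_div, div_eq_div_iff hne hI, qInt]
    simp only [node, hzero, Nat.cast_zero, zero_sub]
    simp only [two_mul, zpow_add₀ hq, zpow_sub₀ hq, neg_add, zpow_neg, zpow_one]
    have hu : q ^ (p.count c : ℤ) / q ^ (c : ℤ) ≠ 0 := div_ne_zero (zpow_ne_zero _ hq)
      (zpow_ne_zero _ hq)
    have hv : q ^ (N : ℤ) ≠ 0 := zpow_ne_zero _ hq
    generalize q ^ (p.count c : ℤ) / q ^ (c : ℤ) = u at *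
    generalize q ^ (N : ℤ) = v at *
    have hq2 : q ^ 2 - 1 ≠ 0 := fun h => hκ (by field_simp; linear_combination h)
    field_simp
  rw [← Finset.mul_prod_erase _ _ hcN, ← Finset.mul_prod_erase _
    (fun i => rowNorm q N (fun i => p.count i) i) hcN, heq, hprod, hfac, ← hcomb, hIoo]
  ring

end Step
end Hooks

/-! ### Standard tableaux as growths -/

section Addable

variable {mu : YoungDiagram}

theorem isAddable_rowEnd {i : ℕ} (h : i = 0 ∨ mu.rowLen i < mu.rowLen (i - 1)) :
    IsAddable mu (i, mu.rowLen i) := by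
  refine ⟨fun hm => absurd (YoungDiagram.mem_iff_lt_rowLen.mp hm) (lt_irrefl _), ?_⟩
  rintro ⟨c, d⟩ ⟨a, b⟩ hle hmem
  simp only [Finset.coe_insert, Set.mem_insert_iff, Finset.mem_coe, YoungDiagram.mem_cells]
    at hmem ⊢
  rcases hmem with he | hmem
  · rw [he] at hle
    obtain ⟨ha, hb⟩ : a ≤ i ∧ b ≤ mu.rowLen i := hle
    rcases ha.lt_or_eq with ha' | rfl
    · right
      refine mu.up_left_mem (show a ≤ i - 1 by omega) hb (YoungDiagram.mem_iff_lt_rowLen.mpr ?_)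
      omega
    · rcases hb.lt_or_eq with hb' | rfl
      · exact Or.inr (YoungDiagram.mem_iff_lt_rowLen.mpr hb')
      · exact Or.inl rfl
  · exact Or.inr (mu.up_left_mem hle.1 hle.2 hmem)

/-- Two different cells with equal content are comparable, so that they are not both addable. -/
theorem IsAddable.eq_of_content_eq {c d : ℕ × ℕ} (hc : IsAddable mu c) (hd : IsAddable mu d)
    (h : content c = content d) : c = d := by
  have key : ∀ {c d : ℕ × ℕ}, IsAddable mu c → IsAddable mu d → content c = content d →
      c.1 < d.1 → False := by
    intro c d hc hd h hlt
    simp only [content] at h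
    have hle : c ≤ d := ⟨hlt.le, by omega⟩
    have := hd.2 hle (by simp)
    simp only [Finset.coe_insert, Set.mem_insert_iff, Finset.mem_coe,
      YoungDiagram.mem_cells] at this
    rcases this with rfl | h'
    · exact lt_irrefl _ hlt
    · exact hc.1 h'
  rcases lt_trichotomy c.1 d.1 with h' | h' | h'
  · exact (key hc hd h h').elim
  · simp only [content] at h
    exact Prod.ext h' (by omega)
  · exact (key hd hc h.symm h').elim

end Addable

namespace StandardTableau

variable {n : ℕ} {lam : YoungDiagram} (t : StandardTableau n lam)

theorem mem_shape {k : ℕ} {c : ℕ × ℕ} :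
    c ∈ t.shape k ↔ ∃ l : Fin n, l.1 < k ∧ (t.cell l).1 = c := by
  rw [← YoungDiagram.mem_cells]
  simp [shape]

theorem cell_notMem_shape {k : ℕ} (h : k < n) : (t.cell ⟨k, h⟩).1 ∉ t.shape k := by
  rw [mem_shape]
  rintro ⟨l, hl, he⟩
  rw [t.cell.injective (Subtype.ext he)] at hl
  exact lt_irrefl _ hl

theorem cells_shape_succ {k : ℕ} (h : k < n) :
    (t.shape (k + 1)).cells = insert (t.cell ⟨k, h⟩).1 (t.shape k).cells := by
  ext c
  rw [Finset.mem_insert, YoungDiagram.mem_cells, YoungDiagram.mem_cells, mem_shape, mem_shape]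
  constructor
  · rintro ⟨l, hl, rfl⟩
    rcases Nat.lt_succ_iff_lt_or_eq.mp hl with h' | h'
    · exact Or.inr ⟨l, h', rfl⟩
    · exact Or.inl (by rw [show l = ⟨k, h⟩ from Fin.ext h'])
  · rintro (rfl | ⟨l, hl, rfl⟩)
    · exact ⟨⟨k, h⟩, Nat.lt_succ_self k, rfl⟩
    · exact ⟨l, hl.trans (Nat.lt_succ_self k), rfl⟩

theorem shape_zero : (t.shape 0).cells = ∅ := by
  ext c
  rw [YoungDiagram.mem_cells, mem_shape]
  simp

theorem shape_self : t.shape n = lam := by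
  ext c
  rw [YoungDiagram.mem_cells, YoungDiagram.mem_cells, mem_shape]
  constructor
  · rintro ⟨l, -, rfl⟩
    exact (YoungDiagram.mem_cells _).mp (t.cell l).2
  · intro hc
    obtain ⟨l, hl⟩ := t.cell.surjective ⟨c, (YoungDiagram.mem_cells _).mpr hc⟩
    exact ⟨l, l.2, by rw [hl]⟩

theorem isAddable_cell {k : ℕ} (h : k < n) : IsAddable (t.shape k) (t.cell ⟨k, h⟩).1 :=
  ⟨t.cell_notMem_shape h, by rw [← t.cells_shape_succ h]; exact (t.shape (k + 1)).isLowerSet⟩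

/-- The rows of the cells that contain `1, …, k`, the last one first. -/
def growth : ∀ k : ℕ, k ≤ n → List ℕ
  | 0, _ => []
  | k + 1, h => (t.cell ⟨k, h⟩).1.1 :: growth k (Nat.le_of_succ_le h)

theorem length_growth (k : ℕ) (h : k ≤ n) : (t.growth k h).length = k := by
  induction k with
  | zero => rfl
  | succ k ih => rw [growth, List.length_cons, ih]

theorem rowLen_shape (k : ℕ) (h : k ≤ n) (i : ℕ) :
    (t.shape k).rowLen i = (t.growth k h).count i := by
  induction k with
  | zero => simp [YoungDiagram.rowLen_eq_card, YoungDiagram.row, t.shape_zero, growth]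
  | succ k ih =>
    have ih := ih (by omega)
    rw [YoungDiagram.rowLen_eq_card, YoungDiagram.row] at ih ⊢
    rw [t.cells_shape_succ h, Finset.filter_insert, growth, List.count_cons, ← ih]
    have := t.cell_notMem_shape h
    split_ifs with h1 h2 h2
    · rw [Finset.card_insert_of_notMem]
      rw [Finset.mem_filter, YoungDiagram.mem_cells]
      exact fun h' => this h'.1
    · exact absurd (beq_iff_eq.mpr h1) h2
    · exact absurd (beq_iff_eq.mp h2) h1
    · rfl

theorem cell_snd {k : ℕ} (h : k < n) :
    (t.cell ⟨k, h⟩).1.2 = (t.shape k).rowLen (t.cell ⟨k, h⟩).1.1 := by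
  have h1 := t.cell_notMem_shape h
  have h2 := (t.isAddable_cell h).2
  generalize (t.cell ⟨k, h⟩).1 = c at *
  obtain ⟨a, b⟩ := c
  rw [YoungDiagram.mem_iff_lt_rowLen] at h1
  by_contra hne
  simp only at hne
  have hb : b - 1 + 1 = b := by omega
  have h3 := h2 (show (a, b - 1) ≤ (a, b) from ⟨le_rfl, Nat.sub_le b 1⟩) (by simp)
  simp only [Finset.coe_insert, Set.mem_insert_iff, Finset.mem_coe, YoungDiagram.mem_cells,
    Prod.mk.injEq, YoungDiagram.mem_iff_lt_rowLen] at h3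
  omega

theorem rowLen_lt_of_cell {k : ℕ} (h : k < n) : (t.cell ⟨k, h⟩).1.1 = 0 ∨
    (t.shape k).rowLen (t.cell ⟨k, h⟩).1.1 < (t.shape k).rowLen ((t.cell ⟨k, h⟩).1.1 - 1) := by
  have h1 := t.cell_snd h
  have h2 := (t.isAddable_cell h).2
  generalize (t.cell ⟨k, h⟩).1 = c at *
  obtain ⟨a, b⟩ := c
  rcases Nat.eq_zero_or_pos a with rfl | ha
  · exact Or.inl rfl
  · right
    have h3 := h2 (show (a - 1, b) ≤ (a, b) from ⟨Nat.sub_le a 1, le_rfl⟩) (by simp)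
    simp only [Finset.coe_insert, Set.mem_insert_iff, Finset.mem_coe, YoungDiagram.mem_cells,
      Prod.mk.injEq, YoungDiagram.mem_iff_lt_rowLen] at h3
    simp only at h1 ⊢
    omega

theorem isGrowth_growth (k : ℕ) (h : k ≤ n) : IsGrowth (t.growth k h) := by
  induction k with
  | zero => trivial
  | succ k ih =>
    refine ⟨ih (by omega), ?_⟩
    have := t.rowLen_lt_of_cell h
    rwa [t.rowLen_shape k (by omega), t.rowLen_shape k (by omega)] at this

theorem qContent_rowEnd (k : ℕ) (h : k ≤ n) (i : ℕ) :
    qContent q (i, (t.shape k).rowLen i) = node q (t.growth k h) i := by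
  rw [qContent, node, content, t.rowLen_shape k h]

theorem sigma_eq_node {k : ℕ} (h : k < n) :
    t.sigma q ⟨k, h⟩ = node q (t.growth k h.le) (t.cell ⟨k, h⟩).1.1 := by
  rw [← qContent_rowEnd, ← t.cell_snd h]
  rfl

/-- The polynomial that defines the idempotent picks out the cell of `k + 1` among the addable
cells. -/
theorem eval_interpolant (hq : q ≠ 0) (hq1 : ∀ d : ℤ, d ≠ 0 → q ^ d ≠ 1) {k : ℕ} (h : k < n)
    {i : ℕ} (hi : IsGrowth (i :: t.growth k h.le)) :
    (∏ c ∈ (addable (t.shape k)).erase (t.cell ⟨k, h⟩).1,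
      Polynomial.C (t.sigma q ⟨k, h⟩ - qContent q c)⁻¹ *
        (Polynomial.X - Polynomial.C (qContent q c))).eval (node q (t.growth k h.le) i) =
      if i = (t.cell ⟨k, h⟩).1.1 then 1 else 0 := by
  have hadd : ∀ c, c ∈ addable (t.shape k) ↔ IsAddable (t.shape k) c := fun c => by
    simp [addable]
  rw [Polynomial.eval_prod]
  split_ifs with he
  · refine Finset.prod_eq_one fun c hc => ?_
    obtain ⟨hc1, hc2⟩ := Finset.mem_erase.mp hc
    rw [Polynomial.eval_mul, Polynomial.eval_C, Polynomial.eval_sub, Polynomial.eval_X,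
      Polynomial.eval_C, he, ← t.sigma_eq_node h]
    refine inv_mul_cancel₀ (sub_ne_zero.mpr fun heq => hc1 ?_)
    have := zpow_injective_of_ne_one hq hq1 heq
    exact ((t.isAddable_cell h).eq_of_content_eq ((hadd c).mp hc2) (by simpa using this)).symm
  · refine Finset.prod_eq_zero (i := (i, (t.shape k).rowLen i)) ?_ ?_
    · refine Finset.mem_erase.mpr ⟨fun h' => he (Prod.ext_iff.mp h').1, (hadd _).mpr ?_⟩
      refine isAddable_rowEnd ?_
      rw [t.rowLen_shape k h.le, t.rowLen_shape k h.le]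
      exact hi.2
    · rw [t.qContent_rowEnd k h.le]
      simp

/-- The idempotent of a standard tableau corresponds to the indicator function of its growth. -/
theorem exists_partialIdempotent_mem (hq : q ≠ 0) (hq1 : ∀ d : ℤ, d ≠ 0 → q ^ d ≠ 1) (k : ℕ)
    (h : k ≤ n) : ∃ f, (t.partialIdempotent q k h, f) ∈ symbolAlgebra q k ∧
      ∀ p, IsGrowth p → p.length = k → f p = if p = t.growth k h then 1 else 0 := by
  induction k with
  | zero =>
    refine ⟨1, one_mem _, fun p _ hl => ?_⟩
    rw [List.length_eq_zero_iff] at hl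
    rw [hl, growth, if_pos rfl, Pi.one_apply]
  | succ k ih =>
    obtain ⟨f, hf, hf'⟩ := ih (by omega)
    rw [partialIdempotent]
    set P := ∏ c ∈ (addable (t.shape k)).erase (t.cell ⟨k, h⟩).1,
      Polynomial.C (t.sigma q ⟨k, h⟩ - qContent q c)⁻¹ *
        (Polynomial.X - Polynomial.C (qContent q c)) with hP
    have hmem : (Polynomial.aeval (jucysMurphy q k) P, Polynomial.aeval (headNode q) P) ∈
        symbolAlgebra q (k + 1) := by
      have h1 := Algebra.adjoin_le (Set.singleton_subset_iff.mpr (jucysMurphy_mem (q := q) k))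
        (Polynomial.aeval_mem_adjoin_singleton K (jucysMurphy q k, headNode q) (p := P))
      have h2 := Polynomial.aeval_algHom_apply
        (AlgHom.fst K (HeckeAlgebra q (k + 1)) (List ℕ → K)) (jucysMurphy q k, headNode q) P
      have h3 := Polynomial.aeval_algHom_apply
        (AlgHom.snd K (HeckeAlgebra q (k + 1)) (List ℕ → K)) (jucysMurphy q k, headNode q) P
      change Polynomial.aeval (jucysMurphy q k) P = _ at h2
      change Polynomial.aeval (headNode q) P = _ at h3
      rw [h2, h3]
      exact h1
    refine ⟨_, mul_mem (symbolIncl_mem hf) hmem, fun p hp hl => ?_⟩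
    obtain ⟨i, p, rfl⟩ := List.exists_cons_of_length_eq_add_one hl
    have h3 := Polynomial.aeval_algHom_apply
      (Pi.evalAlgHom K (fun _ : List ℕ => K) (i :: p)) (headNode q) P
    change Polynomial.aeval (node q p i) P = Polynomial.aeval (headNode q) P (i :: p) at h3
    change f p * Polynomial.aeval (headNode q) P (i :: p) = _
    rw [← h3, hf' p hp.1 (by simpa using hl), growth]
    by_cases hpe : p = t.growth k (Nat.le_of_succ_le h)
    · subst hpe
      rw [if_pos rfl, one_mul, Polynomial.coe_aeval_eq_eval, hP, t.eval_interpolant hq hq1 h hp]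
      simp
    · simp [hpe]

theorem growthSum_indicator {N : ℕ} (k : ℕ) (h : k ≤ n) (hN : n ≤ N) :
    growthSum q Q N k (fun p => if p = t.growth k h then 1 else 0) =
      ∏ j : Fin k, weight q Q N (node q (t.growth j (j.2.le.trans h)))
        (t.cell ⟨j, j.2.trans_le h⟩).1.1 := by
  induction k with
  | zero => simp [growthSum, growth]
  | succ k ih =>
    rw [Fin.prod_univ_castSucc]
    have ih := ih (by omega)
    simp only [Fin.val_castSucc, Fin.val_last]
    rw [← ih]
    have hrow : (t.cell ⟨k, h⟩).1.1 ∈ Finset.range (N + 1) := by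
      have := (t.isGrowth_growth (k + 1) h).head_le_length
      rw [t.length_growth] at this
      simp
      omega
    change growthSum q Q N k (growthStep q Q N _) = _
    rw [mul_comm, ← smul_eq_mul, ← map_smul]
    congr 1
    funext p
    rw [growthStep_apply, Finset.sum_eq_single_of_mem _ hrow]
    · simp only [growth, List.cons.injEq, true_and, Pi.smul_apply, smul_eq_mul]
      split_ifs with hp
      · rw [hp]
      · simp
    · intro i _ hi
      simp [growth, hi]

theorem qdim_eq_prod (hq : q ≠ 0) (hq1 : ∀ d : ℤ, d ≠ 0 → q ^ d ≠ 1) :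
    t.qdim q Q = ∏ k : Fin n, weight q Q n (node q (t.growth k k.2.le)) (t.cell k).1.1 := by
  obtain ⟨f, hf, hf'⟩ := t.exists_partialIdempotent_mem hq hq1 n le_rfl
  rw [qdim, idempotent, ocneanuTrace_eq_growthSum hq hq1 le_rfl hf, growthSum_congr hq hf',
    t.growthSum_indicator n le_rfl le_rfl]

theorem normFactor_shape_succ (hq : q ≠ 0) (hq1 : ∀ d : ℤ, d ≠ 0 → q ^ d ≠ 1) {k : ℕ}
    (h : k < n) : normFactor q (t.shape (k + 1)) = normFactor q (t.shape k) *
      hookFactor q n (node q (t.growth k h.le)) (t.cell ⟨k, h⟩).1.1 := by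
  have hzero : ∀ k (h : k ≤ n), (t.shape k).rowLen n = 0 := by
    intro k h
    rw [t.rowLen_shape k h]
    by_contra h0
    have := (t.isGrowth_growth k h).lt_length (Nat.pos_of_ne_zero h0)
    rw [t.length_growth] at this
    omega
  have hrow : ∀ k (h : k ≤ n), (t.shape k).rowLen = fun i => (t.growth k h).count i :=
    fun k h => funext (t.rowLen_shape k h)
  rw [normFactor_eq_prod_rowNorm hq hq1 _ (hzero (k + 1) h),
    normFactor_eq_prod_rowNorm hq hq1 _ (hzero k h.le), hrow (k + 1) h, hrow k h.le]
  exact prod_rowNorm_cons hq hq1 (t.isGrowth_growth (k + 1) h) (by rwa [t.length_growth])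

theorem normFactor_eq_prod (hq : q ≠ 0) (hq1 : ∀ d : ℤ, d ≠ 0 → q ^ d ≠ 1) :
    normFactor q lam =
      ∏ k : Fin n, hookFactor q n (node q (t.growth k k.2.le)) (t.cell k).1.1 := by
  have key : ∀ k (h : k ≤ n), normFactor q (t.shape k) = ∏ j : Fin k,
      hookFactor q n (node q (t.growth j (j.2.le.trans h))) (t.cell ⟨j, j.2.trans_le h⟩).1.1 := by
    intro k h
    induction k with
    | zero => rw [normFactor, t.shape_zero]; simp
    | succ k ih => rw [t.normFactor_shape_succ hq hq1 h, Fin.prod_univ_castSucc, ih (by omega)]; rfl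
  have := key n le_rfl
  rwa [t.shape_self] at this

theorem normFactor_eq_qdim_mul_prod (hq : q ≠ 0) (hq1 : ∀ d : ℤ, d ≠ 0 → q ^ d ≠ 1)
    (hQ : ∀ k : Fin n, Q + (t.sigma q k - 1) / (q - q⁻¹) ≠ 0) :
    normFactor q lam = t.qdim q Q *
      ∏ k : Fin n, (t.sigma q k * (Q + (t.sigma q k - 1) / (q - q⁻¹))⁻¹) := by
  rw [t.qdim_eq_prod hq hq1, t.normFactor_eq_prod hq hq1, ← Finset.prod_mul_distrib]
  refine Finset.prod_congr rfl fun k _ => ?_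
  have hκ := sub_inv_ne_zero hq hq1
  have hk := hQ k
  have hσ : t.sigma q k ≠ 0 := zpow_ne_zero _ hq
  have e := t.sigma_eq_node (q := q) k.2
  simp only [Fin.eta] at e
  rw [weight, ← e]
  have e2 : (q - q⁻¹) * Q + t.sigma q k - 1 =
      (q - q⁻¹) * (Q + (t.sigma q k - 1) / (q - q⁻¹)) := by
    rw [mul_add, mul_div_cancel₀ _ hκ]; ring
  rw [e2]
  generalize Q + (t.sigma q k - 1) / (q - q⁻¹) = z at *
  generalize q - q⁻¹ = κ at *
  field_simp

end StandardTableau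

theorem ratFunc_X_zpow_ne_one (d : ℤ) (hd : d ≠ 0) : (RatFunc.X : RatFunc ℂ) ^ d ≠ 1 := by
  have key : ∀ m : ℕ, m ≠ 0 → (RatFunc.X : RatFunc ℂ) ^ m ≠ 1 := by
    intro m hm h
    have h' : (Polynomial.X ^ m : Polynomial ℂ) = 1 := by
      apply RatFunc.algebraMap_injective ℂ
      simpa using h
    have := congrArg (fun p => Polynomial.coeff p 0) h'
    simp at this
    exact hm this.symm
  rcases Int.natAbs_eq d with h | h
  · rw [h, zpow_natCast]
    exact key _ (by omega)
  · rw [h, zpow_neg, zpow_natCast]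
    exact fun h' => key d.natAbs (by omega) (inv_eq_one.mp h')

end Hecke
end

theorem proposition3 (n : ℕ) (lam : YoungDiagram) (t : Hecke.StandardTableau n lam)
    (Q : RatFunc ℂ)
    (hQ : ∀ k : Fin n,
      Q + (t.sigma RatFunc.X k - 1) / (RatFunc.X - RatFunc.X⁻¹) ≠ 0) :
    Hecke.normFactor (RatFunc.X : RatFunc ℂ) lam =
      t.qdim RatFunc.X Q *
        ∏ k : Fin n, (t.sigma RatFunc.X k *
          (Q + (t.sigma RatFunc.X k - 1) / (RatFunc.X - RatFunc.X⁻¹))⁻¹) :=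
  t.normFactor_eq_qdim_mul_prod RatFunc.X_ne_zero Hecke.ratFunc_X_zpow_ne_one hQ
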